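/- Let $a<0<b$ and $\gamma\ge 0$ be real numbers, and let $C[a,b]$ be the Banach space of real continuous functions on $[a,b]$ with the supremum norm. Let $A$ be the operator in $C[a,b]$ given by $Af=\tfrac12 f''$ on the domain $D(A)$ of all $f\in C[a,b]$ that are twice continuously differentiable on each of the intervals $[a,0]$ and $[0,b]$ separately (with one-sided derivatives at the ends) and satisfy $$f''(a)=f''(b)=0,\qquad f''(0+)=f''(0-),\qquad f'(0+)-f'(0-)=2\gamma f(0).$$ With the Iverson bracket $[\cdot]$, put $$\ell_*(x)=\frac{b-x-2\gamma b x\,[x\le 0]}{b-a-2\gamma ab},\qquad k_*(x)=\frac{x-a-2\gamma a x\,[x\ge 0]}{b-a-2\gamma ab},\qquad x\in[a,b],$$ and let $P:C[a,b]\to C[a,b]$ be given by $Pf=f(a)\ell_*+f(b)k_*$. Then $P$ is a projection ($P^2=P$) onto the span of $\ell_*$ and $k_*$; the operator $A$ is the infinitesimal generator of exactly one strongly continuous semigroup $(e^{tA})_{t\ge0}$ of bounded linear operators on $C[a,b]$; and there are constants $K\ge 0$ and $\kappa>0$ such that, in the operator norm, $$\|e^{tA}-P\|\le K e^{-\kappa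 t}\qquad\text{for all } t\ge 0.$$ -/

import Mathlib

open Set Filter Topology
open scoped NNReal

namespace KilledBM

noncomputable section

/-! ### Strongly continuous semigroups and their generators -/

/-- A strongly continuous semigroup of bounded linear operators on a real normed space. -/
structure C0Semigroup (X : Type*) [NormedAddCommGroup X] [NormedSpace ℝ X] where
  /-- The operator at time `t`. -/
  op : ℝ≥0 → X →L[ℝ] X
  op_zero : op 0 = ContinuousLinearMap.id ℝ X
  op_add : ∀ s t : ℝ≥0, op (s + t) = (op s).comp (op t)
  tendsto_zero : ∀ f : X, Tendsto (fun t : ℝ≥0 => op t f) (𝓝 0) (𝓝 f)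

/-- The (possibly unbounded) operator `A` is the infinitesimal generator of `S`, that is, `S` is
the semigroup `t ↦ exp (t A)`: a vector `f` is in the domain of `A` with `A f = g` if and only if
`(S t f - f) / t` converges in norm to `g` as `t → 0+`. -/
def C0Semigroup.IsGeneratedBy {X : Type*} [NormedAddCommGroup X] [NormedSpace ℝ X]
    (S : C0Semigroup X) (A : X →ₗ.[ℝ] X) : Prop :=
  ∀ f g : X, (f, g) ∈ A.graph ↔
    Tendsto (fun t : ℝ≥0 => (t : ℝ)⁻¹ • (S.op t f - f)) (𝓝[>] 0) (𝓝 g)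

/-! ### The operator `A` -/

variable {a b : ℝ}

/-- A function on `[a, b]` viewed as a function on the line. Only its values on `[a, b]` matter
below: all derivatives are taken within `[a, 0]` or within `[0, b]`. -/
def extendLine (ha : a < 0) (hb : 0 < b) (f : C(Icc a b, ℝ)) : ℝ → ℝ :=
  IccExtend (ha.trans hb).le f

/-- First derivative within `[a, 0]` (one-sided at the ends). -/
def dL (ha : a < 0) (hb : 0 < b) (f : C(Icc a b, ℝ)) : ℝ → ℝ :=
  derivWithin (extendLine ha hb f) (Icc a 0)

/-- First derivative within `[0, b]` (one-sided at the ends). -/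
def dR (ha : a < 0) (hb : 0 < b) (f : C(Icc a b, ℝ)) : ℝ → ℝ :=
  derivWithin (extendLine ha hb f) (Icc 0 b)

/-- Second derivative within `[a, 0]` (one-sided at the ends). -/
def ddL (ha : a < 0) (hb : 0 < b) (f : C(Icc a b, ℝ)) : ℝ → ℝ :=
  iteratedDerivWithin 2 (extendLine ha hb f) (Icc a 0)

/-- Second derivative within `[0, b]` (one-sided at the ends). -/
def ddR (ha : a < 0) (hb : 0 < b) (f : C(Icc a b, ℝ)) : ℝ → ℝ :=
  iteratedDerivWithin 2 (extendLine ha hb f) (Icc 0 b)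

/-- Membership in the domain of `A`: `f` is twice continuously differentiable on `[a, 0]` and on
`[0, b]` separately, `f''(a) = f''(b) = 0`, `f''(0+) = f''(0-)` and
`f'(0+) - f'(0-) = 2 γ f(0)`. -/
structure InDomain (ha : a < 0) (hb : 0 < b) (γ : ℝ) (f : C(Icc a b, ℝ)) : Prop where
  contDiffL : ContDiffOn ℝ 2 (extendLine ha hb f) (Icc a 0)
  contDiffR : ContDiffOn ℝ 2 (extendLine ha hb f) (Icc 0 b)
  ddL_left : ddL ha hb f a = 0
  ddR_right : ddR ha hb f b = 0
  dd_zero : ddR ha hb f 0 = ddL ha hb f 0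
  jump : dR ha hb f 0 - dL ha hb f 0 = 2 * γ * f ⟨0, ha.le, hb.le⟩

theorem extendLine_add (ha : a < 0) (hb : 0 < b) (f g : C(Icc a b, ℝ)) :
    extendLine ha hb (f + g) = extendLine ha hb f + extendLine ha hb g := rfl

theorem extendLine_smul (ha : a < 0) (hb : 0 < b) (c : ℝ) (f : C(Icc a b, ℝ)) :
    extendLine ha hb (c • f) = c • extendLine ha hb f := rfl

theorem dd_add {p q : ℝ} (hpq : p < q) {F G : ℝ → ℝ} (hF : ContDiffOn ℝ 2 F (Icc p q))
    (hG : ContDiffOn ℝ 2 G (Icc p q)) {x : ℝ} (hx : x ∈ Icc p q) :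
    iteratedDerivWithin 2 (F + G) (Icc p q) x
      = iteratedDerivWithin 2 F (Icc p q) x + iteratedDerivWithin 2 G (Icc p q) x :=
  iteratedDerivWithin_add hx (uniqueDiffOn_Icc hpq) (hF x hx) (hG x hx)

theorem dd_smul {p q : ℝ} (hpq : p < q) {F : ℝ → ℝ} (hF : ContDiffOn ℝ 2 F (Icc p q))
    (c : ℝ) {x : ℝ} (hx : x ∈ Icc p q) :
    iteratedDerivWithin 2 (c • F) (Icc p q) x = c * iteratedDerivWithin 2 F (Icc p q) x :=
  iteratedDerivWithin_const_smul hx (uniqueDiffOn_Icc hpq) c (hF x hx)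

theorem InDomain.add {ha : a < 0} {hb : 0 < b} {γ : ℝ} {f g : C(Icc a b, ℝ)}
    (hf : InDomain ha hb γ f) (hg : InDomain ha hb γ g) : InDomain ha hb γ (f + g) where
  contDiffL := hf.contDiffL.add hg.contDiffL
  contDiffR := hf.contDiffR.add hg.contDiffR
  ddL_left := by
    have h := dd_add ha hf.contDiffL hg.contDiffL (left_mem_Icc.2 ha.le)
    have h1 := hf.ddL_left
    have h2 := hg.ddL_left
    simp only [ddL, extendLine_add] at *
    rw [h, h1, h2, add_zero]
  ddR_right := by
    have h := dd_add hb hf.contDiffR hg.contDiffR (right_mem_Icc.2 hb.le)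
    have h1 := hf.ddR_right
    have h2 := hg.ddR_right
    simp only [ddR, extendLine_add] at *
    rw [h, h1, h2, add_zero]
  dd_zero := by
    have h := dd_add ha hf.contDiffL hg.contDiffL (right_mem_Icc.2 ha.le)
    have h' := dd_add hb hf.contDiffR hg.contDiffR (left_mem_Icc.2 hb.le)
    have h1 := hf.dd_zero
    have h2 := hg.dd_zero
    simp only [ddL, ddR, extendLine_add] at *
    rw [h, h', h1, h2]
  jump := by
    have h := derivWithin_add
      (hf.contDiffL.differentiableOn (by norm_num) 0 (right_mem_Icc.2 ha.le))
      (hg.contDiffL.differentiableOn (by norm_num) 0 (right_mem_Icc.2 ha.le))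
    have h' := derivWithin_add
      (hf.contDiffR.differentiableOn (by norm_num) 0 (left_mem_Icc.2 hb.le))
      (hg.contDiffR.differentiableOn (by norm_num) 0 (left_mem_Icc.2 hb.le))
    have h1 := hf.jump
    have h2 := hg.jump
    simp only [dL, dR, extendLine_add, ContinuousMap.add_apply] at *
    rw [h, h']
    linear_combination h1 + h2

theorem InDomain.smul {ha : a < 0} {hb : 0 < b} {γ : ℝ} {f : C(Icc a b, ℝ)}
    (c : ℝ) (hf : InDomain ha hb γ f) : InDomain ha hb γ (c • f) where
  contDiffL := hf.contDiffL.const_smul c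
  contDiffR := hf.contDiffR.const_smul c
  ddL_left := by
    have h := dd_smul ha hf.contDiffL c (left_mem_Icc.2 ha.le)
    have h1 := hf.ddL_left
    simp only [ddL, extendLine_smul] at *
    rw [h, h1, mul_zero]
  ddR_right := by
    have h := dd_smul hb hf.contDiffR c (right_mem_Icc.2 hb.le)
    have h1 := hf.ddR_right
    simp only [ddR, extendLine_smul] at *
    rw [h, h1, mul_zero]
  dd_zero := by
    have h := dd_smul ha hf.contDiffL c (right_mem_Icc.2 ha.le)
    have h' := dd_smul hb hf.contDiffR c (left_mem_Icc.2 hb.le)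
    have h1 := hf.dd_zero
    simp only [ddL, ddR, extendLine_smul] at *
    rw [h, h', h1]
  jump := by
    have h := derivWithin_const_smul c
      (hf.contDiffL.differentiableOn (by norm_num) 0 (right_mem_Icc.2 ha.le))
    have h' := derivWithin_const_smul c
      (hf.contDiffR.differentiableOn (by norm_num) 0 (left_mem_Icc.2 hb.le))
    have h1 := hf.jump
    simp only [dL, dR, extendLine_smul, ContinuousMap.smul_apply, smul_eq_mul] at *
    rw [h, h']
    linear_combination c * h1

theorem inDomain_zero (ha : a < 0) (hb : 0 < b) (γ : ℝ) : InDomain ha hb γ 0 := by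
  have h : extendLine ha hb (0 : C(Icc a b, ℝ)) = fun _ => 0 := rfl
  constructor <;> simp [dL, dR, ddL, ddR, h, contDiffOn_const]

/-- The domain of `A`, a linear subspace of `C[a, b]`. -/
def domainA (ha : a < 0) (hb : 0 < b) (γ : ℝ) : Submodule ℝ C(Icc a b, ℝ) where
  carrier := {f | InDomain ha hb γ f}
  add_mem' hf hg := hf.add hg
  zero_mem' := inDomain_zero ha hb γ
  smul_mem' c _ hf := hf.smul c

/-- The second derivative of a function in the domain of `A`, as a function on `[a, b]`: it is
computed within `[a, 0]` at points `x ≤ 0` and within `[0, b]` at points `x > 0`. -/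
def ddFun (ha : a < 0) (hb : 0 < b) (f : C(Icc a b, ℝ)) (x : ℝ) : ℝ :=
  if x ≤ 0 then ddL ha hb f x else ddR ha hb f x

theorem InDomain.continuous_ddFun {ha : a < 0} {hb : 0 < b} {γ : ℝ} {f : C(Icc a b, ℝ)}
    (hf : InDomain ha hb γ f) : Continuous fun x : Icc a b => ddFun ha hb f x := by
  have hL : ContinuousOn (ddL ha hb f) (Icc a 0) :=
    hf.contDiffL.continuousOn_iteratedDerivWithin (by norm_num) (uniqueDiffOn_Icc ha)
  have hR : ContinuousOn (ddR ha hb f) (Icc 0 b) :=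
    hf.contDiffR.continuousOn_iteratedDerivWithin (by norm_num) (uniqueDiffOn_Icc hb)
  unfold ddFun
  refine continuous_if_le continuous_subtype_val continuous_const ?_ ?_ ?_
  · exact hL.comp continuous_subtype_val.continuousOn fun x hx => ⟨x.2.1, hx⟩
  · exact hR.comp continuous_subtype_val.continuousOn fun x hx => ⟨hx, x.2.2⟩
  · intro x hx
    rw [hx]
    exact hf.dd_zero.symm

/-- The operator `A f = f'' / 2` on the domain `domainA`. -/
def opA (ha : a < 0) (hb : 0 < b) (γ : ℝ) : C(Icc a b, ℝ) →ₗ.[ℝ] C(Icc a b, ℝ) where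
  domain := domainA ha hb γ
  toFun :=
    { toFun := fun f => ⟨fun x => (1 / 2) * ddFun ha hb f.1 x,
        continuous_const.mul (InDomain.continuous_ddFun (γ := γ) f.2)⟩
      map_add' := by
        rintro ⟨f, hf : InDomain ha hb γ f⟩ ⟨g, hg : InDomain ha hb γ g⟩
        ext x
        simp only [Submodule.coe_add, ContinuousMap.coe_mk,
          ContinuousMap.add_apply, ddFun, ddL, ddR, extendLine_add]
        split_ifs with h
        · rw [dd_add ha hf.contDiffL hg.contDiffL ⟨x.2.1, h⟩]; ring
        · rw [dd_add hb hf.contDiffR hg.contDiffR ⟨(not_le.1 h).le, x.2.2⟩]; ring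
      map_smul' := by
        rintro c ⟨f, hf : InDomain ha hb γ f⟩
        ext x
        simp only [Submodule.coe_smul, ContinuousMap.coe_mk, RingHom.id_apply,
          ContinuousMap.smul_apply, smul_eq_mul, ddFun, ddL, ddR, extendLine_smul]
        split_ifs with h
        · rw [dd_smul ha hf.contDiffL c ⟨x.2.1, h⟩]; ring
        · rw [dd_smul hb hf.contDiffR c ⟨(not_le.1 h).le, x.2.2⟩]; ring }

/-! ### The limit operator `P` -/

theorem continuous_mul_iverson_nonneg : Continuous fun x : ℝ => x * (if 0 ≤ x then 1 else 0) := by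
  have h : (fun x : ℝ => x * (if 0 ≤ x then 1 else 0)) = fun x => max x 0 := by
    ext x
    split_ifs with hx
    · simp [hx]
    · simp [(not_le.1 hx).le]
  rw [h]
  fun_prop

theorem continuous_mul_iverson_nonpos : Continuous fun x : ℝ => x * (if x ≤ 0 then 1 else 0) := by
  have h : (fun x : ℝ => x * (if x ≤ 0 then 1 else 0)) = fun x => min x 0 := by
    ext x
    split_ifs with hx
    · simp [hx]
    · simp [(not_le.1 hx).le]
  rw [h]
  fun_prop

/-- `ℓ_*(x) = (b - x - 2 γ b x [x ≤ 0]) / (b - a - 2 γ a b)`. -/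
def ellStar (a b γ : ℝ) : C(Icc a b, ℝ) where
  toFun x := (b - x - 2 * γ * b * (x * (if (x : ℝ) ≤ 0 then 1 else 0))) /
    (b - a - 2 * γ * a * b)
  continuous_toFun := by
    have h := continuous_mul_iverson_nonpos.comp (continuous_subtype_val (p := (· ∈ Icc a b)))
    exact ((continuous_const.sub continuous_subtype_val).sub (continuous_const.mul h)).div_const _

/-- `k_*(x) = (x - a - 2 γ a x [x ≥ 0]) / (b - a - 2 γ a b)`. -/
def kStar (a b γ : ℝ) : C(Icc a b, ℝ) where
  toFun x := (x - a - 2 * γ * a * (x * (if 0 ≤ (x : ℝ) then 1 else 0))) /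
    (b - a - 2 * γ * a * b)
  continuous_toFun := by
    have h := continuous_mul_iverson_nonneg.comp (continuous_subtype_val (p := (· ∈ Icc a b)))
    exact ((continuous_subtype_val.sub continuous_const).sub (continuous_const.mul h)).div_const _

/-- The operator `P f = f(a) ℓ_* + f(b) k_*` on `C[a, b]`. -/
def opP (ha : a < 0) (hb : 0 < b) (γ : ℝ) : C(Icc a b, ℝ) →L[ℝ] C(Icc a b, ℝ) :=
  (ContinuousMap.evalCLM ℝ (⟨a, left_mem_Icc.2 (ha.trans hb).le⟩ : Icc a b)).smulRight
      (ellStar a b γ) +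
    (ContinuousMap.evalCLM ℝ (⟨b, right_mem_Icc.2 (ha.trans hb).le⟩ : Icc a b)).smulRight
      (kStar a b γ)

theorem opP_apply (ha : a < 0) (hb : 0 < b) (γ : ℝ) (f : C(Icc a b, ℝ)) :
    opP ha hb γ f = f ⟨a, left_mem_Icc.2 (ha.trans hb).le⟩ • ellStar a b γ +
      f ⟨b, right_mem_Icc.2 (ha.trans hb).le⟩ • kStar a b γ := rfl

end

end KilledBM

namespace KilledBM

section Exponentials

variable {X Y : Type*} [NormedAddCommGroup X] [NormedSpace ℝ X]
  [NormedAddCommGroup Y] [NormedSpace ℝ Y]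

theorem norm_pow_apply_le (B : X →L[ℝ] X) (L : X →L[ℝ] Y) {c : ℝ} (hc : 0 ≤ c)
    (h : ∀ f, ‖L (B f)‖ ≤ c * ‖L f‖) (n : ℕ) (f : X) : ‖L ((B ^ n) f)‖ ≤ c ^ n * ‖L f‖ := by
  induction n with
  | zero => simp
  | succ n ih =>
    rw [pow_succ' B]
    calc ‖L (B ((B ^ n) f))‖ ≤ c * ‖L ((B ^ n) f)‖ := h _
      _ ≤ c * (c ^ n * ‖L f‖) := by gcongr
      _ = c ^ (n + 1) * ‖L f‖ := by ring

variable [CompleteSpace X]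

theorem exp_add_of_commute_clm {B C : X →L[ℝ] X} (h : Commute B C) :
    NormedSpace.exp (B + C) = NormedSpace.exp B * NormedSpace.exp C :=
  letI : NormedAlgebra ℚ (X →L[ℝ] X) := NormedAlgebra.restrictScalars ℚ ℝ _
  NormedSpace.exp_add_of_commute h

theorem norm_exp_apply_le (B : X →L[ℝ] X) (L : X →L[ℝ] Y) {c : ℝ} (hc : 0 ≤ c)
    (h : ∀ f, ‖L (B f)‖ ≤ c * ‖L f‖) (f : X) :
    ‖L (NormedSpace.exp B f)‖ ≤ Real.exp c * ‖L f‖ := by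
  have h1 := ((ContinuousLinearMap.apply ℝ X f).hasSum
    (NormedSpace.exp_series_hasSum_exp' (𝕂 := ℝ) B)).mapL L
  have h2 := (NormedSpace.exp_series_hasSum_exp' (𝕂 := ℝ) c).mul_right ‖L f‖
  rw [← Real.exp_eq_exp_ℝ] at h2
  refine h1.norm_le_of_bounded h2 fun n => ?_
  simp only [ContinuousLinearMap.apply_apply,
    map_smul, norm_smul, smul_eq_mul, mul_assoc, norm_inv, RCLike.norm_natCast]
  gcongr
  exact norm_pow_apply_le B L hc h n f

/-- A growth estimate for the exponential of `l (l R - 1)` with respect to the seminorm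
`f ↦ ‖L f‖`. -/
theorem norm_exp_yosida_apply_le (R : X →L[ℝ] X) (L : X →L[ℝ] Y) {c l : ℝ} (hc : 0 ≤ c)
    (h : ∀ f, ‖L (R f)‖ ≤ c * ‖L f‖) {t : ℝ} (ht : 0 ≤ t) (f : X) :
    ‖L (NormedSpace.exp (t • (l ^ 2 • R - l • (1 : X →L[ℝ] X))) f)‖ ≤
      Real.exp (t * (l ^ 2 * c - l)) * ‖L f‖ := by
  have hcomm : Commute (algebraMap ℝ (X →L[ℝ] X) (-(t * l))) ((t * l ^ 2) • R) :=
    Algebra.commutes _ _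
  have e : t • (l ^ 2 • R - l • (1 : X →L[ℝ] X)) =
      algebraMap ℝ (X →L[ℝ] X) (-(t * l)) + (t * l ^ 2) • R := by
    rw [Algebra.algebraMap_eq_smul_one]
    module
  rw [e, exp_add_of_commute_clm hcomm, ← NormedSpace.algebraMap_exp_comm,
    ← Real.exp_eq_exp_ℝ, Algebra.algebraMap_eq_smul_one]
  simp only [mul_apply_eq_comp, smul_apply,
    one_apply_eq_self, map_smul, norm_smul, Real.norm_eq_abs, Real.abs_exp]
  have h3 := norm_exp_apply_le ((t * l ^ 2) • R) L (c := t * l ^ 2 * c) (by positivity)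
    (fun g => by
      rw [smul_apply, map_smul, norm_smul, Real.norm_of_nonneg (by positivity),
        mul_assoc (t * l ^ 2) c]
      exact mul_le_mul_of_nonneg_left (h g) (by positivity)) f
  calc _ ≤ Real.exp (-(t * l)) * (Real.exp (t * l ^ 2 * c) * ‖L f‖) := by gcongr
    _ = _ := by rw [← mul_assoc, ← Real.exp_add]; ring_nf

theorem hasDerivAt_exp_smul_apply (B : X →L[ℝ] X) (f : X) (t : ℝ) :
    HasDerivAt (fun s : ℝ => NormedSpace.exp (s • B) f) (NormedSpace.exp (t • B) (B f)) t := by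
  have h := hasDerivAt_exp_smul_const (𝕂 := ℝ) B t
  simpa using h.clm_apply (hasDerivAt_const t f)

theorem norm_exp_sub_exp_le {B C : X →L[ℝ] X} (hBC : Commute B C)
    (hB : ∀ t : ℝ, 0 ≤ t → ∀ f, ‖NormedSpace.exp (t • B) f‖ ≤ ‖f‖)
    (hC : ∀ t : ℝ, 0 ≤ t → ∀ f, ‖NormedSpace.exp (t • C) f‖ ≤ ‖f‖) {t : ℝ} (ht : 0 ≤ t) (f : X) :
    ‖NormedSpace.exp (t • B) f - NormedSpace.exp (t • C) f‖ ≤ t * ‖B f - C f‖ := by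
  have hcomm : ∀ s : ℝ, Commute (s • (B - C)) (t • C) := fun s =>
    ((hBC.sub_left (Commute.refl C)).smul_left s).smul_right t
  have hprod : ∀ s : ℝ, NormedSpace.exp (s • (B - C)) * NormedSpace.exp (t • C) =
      NormedSpace.exp (s • B) * NormedSpace.exp ((t - s) • C) := fun s => by
    rw [← exp_add_of_commute_clm (hcomm s),
      ← exp_add_of_commute_clm ((hBC.smul_left s).smul_right (t - s))]
    congr 1
    module
  have hD : Commute (B - C) (NormedSpace.exp (t • C)) :=
    (((hBC.sub_left (Commute.refl C))).smul_right t).exp_right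
  have hderiv : ∀ s ∈ Icc 0 t, HasDerivWithinAt
      (fun s : ℝ => NormedSpace.exp (s • (B - C)) (NormedSpace.exp (t • C) f))
      (NormedSpace.exp (s • (B - C)) ((B - C) (NormedSpace.exp (t • C) f))) (Icc 0 t) s :=
    fun s _ => (hasDerivAt_exp_smul_apply _ _ s).hasDerivWithinAt
  have key := norm_image_sub_le_of_norm_deriv_le_segment' (C := ‖B f - C f‖) hderiv
    (fun s hs => by
      have e1 : (B - C) (NormedSpace.exp (t • C) f) = NormedSpace.exp (t • C) (B f - C f) := by
        simpa using congrArg (fun T : X →L[ℝ] X => T f) hD.eq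
      have e2 := congrArg (fun T : X →L[ℝ] X => T (B f - C f)) (hprod s)
      simp only [mul_apply_eq_comp] at e2
      rw [e1, e2]
      exact (hB s hs.1 _).trans (hC _ (by linarith [hs.2]) _)) t (right_mem_Icc.2 ht)
  have e3 := congrArg (fun T : X →L[ℝ] X => T f) (hprod t)
  simp only [mul_apply_eq_comp, sub_self, zero_smul, NormedSpace.exp_zero,
    one_apply_eq_self] at e3
  simp only [e3, zero_smul, NormedSpace.exp_zero, one_apply_eq_self, sub_zero] at key
  rwa [mul_comm]

theorem norm_exp_sub_self_le {B : X →L[ℝ] X}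
    (hB : ∀ t : ℝ, 0 ≤ t → ∀ f, ‖NormedSpace.exp (t • B) f‖ ≤ ‖f‖) {t : ℝ} (ht : 0 ≤ t) (f : X) :
    ‖NormedSpace.exp (t • B) f - f‖ ≤ t * ‖B f‖ := by
  simpa using norm_exp_sub_exp_le (C := 0) (Commute.zero_right B) hB (by simp) ht f

/-- A first-order Taylor estimate for the orbits of `exp (t B)`. -/
theorem norm_exp_sub_self_sub_le {B : X →L[ℝ] X}
    (hB : ∀ t : ℝ, 0 ≤ t → ∀ f, ‖NormedSpace.exp (t • B) f‖ ≤ ‖f‖) {t : ℝ} (ht : 0 ≤ t)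
    (f g k : X) : ‖NormedSpace.exp (t • B) f - f - t • g‖ ≤
      t * (‖B f - g‖ + 2 * ‖g - k‖ + t * ‖B k‖) := by
  have hderiv : ∀ s ∈ Icc 0 t, HasDerivWithinAt
      (fun s : ℝ => NormedSpace.exp (s • B) f - s • g)
      (NormedSpace.exp (s • B) (B f) - (1 : ℝ) • g) (Icc 0 t) s :=
    fun s _ => ((hasDerivAt_exp_smul_apply B f s).sub
      ((hasDerivAt_id s).smul_const g)).hasDerivWithinAt
  have key := norm_image_sub_le_of_norm_deriv_le_segment'
    (C := ‖B f - g‖ + 2 * ‖g - k‖ + t * ‖B k‖) hderiv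
    (fun s hs => by
      have e : NormedSpace.exp (s • B) (B f) - (1 : ℝ) • g =
          NormedSpace.exp (s • B) (B f - g) + (NormedSpace.exp (s • B) (g - k) +
            ((NormedSpace.exp (s • B) k - k) + (k - g))) := by
        simp only [map_sub, one_smul]
        abel
      rw [e]
      have h1 := norm_add_le (NormedSpace.exp (s • B) (B f - g)) (NormedSpace.exp (s • B) (g - k) +
            ((NormedSpace.exp (s • B) k - k) + (k - g)))
      have h2 := norm_add_le (NormedSpace.exp (s • B) (g - k))
            ((NormedSpace.exp (s • B) k - k) + (k - g))
      have h3 := norm_add_le (NormedSpace.exp (s • B) k - k) (k - g)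
      have h4 := norm_exp_sub_self_le hB hs.1 k
      have h5 : s * ‖B k‖ ≤ t * ‖B k‖ := by gcongr; exact hs.2.le
      rw [norm_sub_rev k g] at h3
      linarith [hB s hs.1 (B f - g), hB s hs.1 (g - k)]) t (right_mem_Icc.2 ht)
  simp only [zero_smul, NormedSpace.exp_zero, one_apply_eq_self, sub_zero] at key
  rw [mul_comm, sub_right_comm]
  exact key

end Exponentials

section LumerPhillips

variable {X : Type*} [NormedAddCommGroup X] [NormedSpace ℝ X]

/-- An operator `A` satisfying the assumptions of the Lumer–Phillips theorem. -/
structure IsMDissipative (A : X →ₗ.[ℝ] X) : Prop where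
  dissipative : ∀ l : ℝ, 0 < l → ∀ f h : X, (f, h) ∈ A.graph → l * ‖f‖ ≤ ‖l • f - h‖
  surjective : ∀ l : ℝ, 0 < l → ∀ g : X, ∃ f h : X, (f, h) ∈ A.graph ∧ l • f - h = g
  dense : Dense (A.domain : Set X)

/-- `R l` is the resolvent `(l - A)⁻¹` for all `l > 0`. -/
structure IsResolvent (A : X →ₗ.[ℝ] X) (R : ℝ → X →L[ℝ] X) : Prop where
  mem_graph : ∀ l : ℝ, 0 < l → ∀ g, (R l g, l • R l g - g) ∈ A.graph
  apply_eq : ∀ l : ℝ, 0 < l → ∀ f h, (f, h) ∈ A.graph → R l (l • f - h) = f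

theorem IsMDissipative.exists_resolvent {A : X →ₗ.[ℝ] X} (hA : IsMDissipative A) :
    ∃ R : ℝ → X →L[ℝ] X, IsResolvent A R := by
  have hex : ∀ l : ℝ, 0 < l → ∀ g : X, ∃ f, (f, l • f - g) ∈ A.graph := fun l hl g => by
    obtain ⟨f, h, hf, rfl⟩ := hA.surjective l hl g
    exact ⟨f, by simpa using hf⟩
  have huniq : ∀ l : ℝ, 0 < l → ∀ g f f' : X, (f, l • f - g) ∈ A.graph →
      (f', l • f' - g) ∈ A.graph → f = f' := fun l hl g f f' hf hf' => by
    have h := hA.dissipative l hl _ _ (A.graph.sub_mem hf hf')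
    have e : l • (f - f') - (l • f - g - (l • f' - g)) = 0 := by module
    rw [e, norm_zero] at h
    have : ‖f - f'‖ ≤ 0 := by
      by_contra! hc
      exact absurd h (not_le.2 (mul_pos hl hc))
    exact sub_eq_zero.1 (norm_le_zero_iff.1 this)
  have hR : ∀ l : ℝ, ∃ T : X →L[ℝ] X, 0 < l → ∀ g, (T g, l • T g - g) ∈ A.graph := by
    intro l
    by_cases hl : 0 < l
    · choose r hr using hex l hl
      refine ⟨LinearMap.mkContinuous
        { toFun := r
          map_add' := fun x y => huniq l hl (x + y) _ _ (hr _) (by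
            convert A.graph.add_mem (hr x) (hr y) using 1
            simp only [Prod.mk_add_mk, Prod.mk.injEq, true_and]
            module)
          map_smul' := fun c x => huniq l hl (c • x) _ _ (hr _) (by
            convert A.graph.smul_mem c (hr x) using 1
            simp only [Prod.smul_mk, Prod.mk.injEq, RingHom.id_apply, true_and]
            module) } l⁻¹ (fun g => ?_), fun _ g => hr g⟩
      have h := hA.dissipative l hl _ _ (hr g)
      rw [sub_sub_cancel] at h
      rwa [LinearMap.coe_mk, AddHom.coe_mk, inv_mul_eq_div, le_div_iff₀' hl]
    · exact ⟨0, fun h => absurd h hl⟩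
  choose R hR using hR
  refine ⟨R, hR, fun l hl f h hf => huniq l hl (l • f - h) _ _ (hR l hl _) (by simpa using hf)⟩

variable {A : X →ₗ.[ℝ] X} {R : ℝ → X →L[ℝ] X}

theorem IsResolvent.norm_comp_le {Y : Type*} [NormedAddCommGroup Y] [NormedSpace ℝ Y]
    (hR : IsResolvent A R) (L : X →L[ℝ] Y) {c l : ℝ} (hl : 0 < l) (hlc : 0 < l + c)
    (h : ∀ f h, (f, h) ∈ A.graph → (l + c) * ‖L f‖ ≤ ‖L (l • f - h)‖) (g : X) :
    ‖L (R l g)‖ ≤ (l + c)⁻¹ * ‖L g‖ := by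
  have := h _ _ (hR.mem_graph l hl g)
  rw [sub_sub_cancel] at this
  rwa [inv_mul_eq_div, le_div_iff₀' hlc]

theorem IsResolvent.norm_le (hA : IsMDissipative A) (hR : IsResolvent A R) {l : ℝ} (hl : 0 < l)
    (g : X) : ‖R l g‖ ≤ l⁻¹ * ‖g‖ := by
  simpa using hR.norm_comp_le (ContinuousLinearMap.id ℝ X) (c := 0) hl (by simpa)
    (fun f h hf => by simpa using hA.dissipative l hl f h hf) g

theorem IsResolvent.commute (hR : IsResolvent A R) {l m : ℝ} (hl : 0 < l) (hm : 0 < m) :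
    Commute (R l) (R m) := by
  rcases eq_or_ne l m with rfl | hlm
  · exact Commute.refl _
  have key : ∀ l m : ℝ, 0 < l → 0 < m → ∀ g, R m g = R l g + (l - m) • R l (R m g) := by
    intro l m hl hm g
    have h := hR.apply_eq l hl _ _ (hR.mem_graph m hm g)
    rw [← map_smul, ← map_add]
    nth_rewrite 1 [← h]
    congr 1
    module
  ext g
  have h1 := key l m hl hm g
  have h2 := key m l hm hl g
  have h3 : (l - m) • (R l (R m g) - R m (R l g)) = 0 := by
    have : (l - m) • (R l (R m g) - R m (R l g)) =
      (l - m) • R l (R m g) + (m - l) • R m (R l g) := by module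
    rw [this, ← sub_eq_iff_eq_add'.2 h1, ← sub_eq_iff_eq_add'.2 h2]
    abel
  rw [smul_eq_zero, or_iff_right (sub_ne_zero.2 hlm), sub_eq_zero] at h3
  exact h3

theorem IsResolvent.smul_apply_sub (hR : IsResolvent A R) {l : ℝ} (hl : 0 < l) {f h : X}
    (hf : (f, h) ∈ A.graph) : l • R l f - f = R l h := by
  have := hR.apply_eq l hl f h hf
  rw [map_sub, map_smul] at this
  nth_rewrite 2 [← this]
  abel

/-- The Yosida approximation `l² R(l) - l` of `A`. -/
noncomputable def yosida (R : ℝ → X →L[ℝ] X) (l : ℝ) : X →L[ℝ] X :=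
  l ^ 2 • R l - l • (1 : X →L[ℝ] X)

theorem IsResolvent.yosida_apply (hR : IsResolvent A R) {l : ℝ} (hl : 0 < l) {f h : X}
    (hf : (f, h) ∈ A.graph) : yosida R l f = l • R l h := by
  rw [← hR.smul_apply_sub hl hf]
  simp only [yosida, sub_apply, smul_apply, one_apply_eq_self]
  module

theorem IsResolvent.norm_yosida_le (hA : IsMDissipative A) (hR : IsResolvent A R) {l : ℝ}
    (hl : 0 < l) {f h : X} (hf : (f, h) ∈ A.graph) : ‖yosida R l f‖ ≤ ‖h‖ := by
  rw [hR.yosida_apply hl hf, norm_smul, Real.norm_of_nonneg hl.le]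
  have := mul_le_mul_of_nonneg_left (hR.norm_le hA hl h) hl.le
  rwa [← mul_assoc, mul_inv_cancel₀ hl.ne', one_mul] at this

theorem IsResolvent.commute_yosida (hR : IsResolvent A R) {l m : ℝ} (hl : 0 < l) (hm : 0 < m) :
    Commute (yosida R l) (yosida R m) := by
  have h1 : ∀ (c : ℝ) (T : X →L[ℝ] X), Commute T (c • 1) := fun c T => by
    rw [← Algebra.algebraMap_eq_smul_one]
    exact (Algebra.commutes c T).symm
  unfold yosida
  exact ((((hR.commute hl hm).smul_left _).smul_right _).sub_right (h1 _ _)).sub_left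
    (h1 _ _).symm

theorem tendsto_of_dense {B : ℕ → X →L[ℝ] X} {C : ℝ} (hB : ∀ n f, ‖B n f‖ ≤ C * ‖f‖)
    {s : Set X} (hs : Dense s) (h : ∀ f ∈ s, Tendsto (fun n => B n f) atTop (𝓝 f)) (f : X) :
    Tendsto (fun n => B n f) atTop (𝓝 f) := by
  have hC : 0 < |C| + 1 := by positivity
  rw [Metric.tendsto_atTop]
  intro ε hε
  obtain ⟨k, hk, hks⟩ := Metric.dense_iff.1 hs f (ε / 3 / (|C| + 1)) (by positivity)
  rw [Metric.mem_ball, dist_comm, dist_eq_norm, lt_div_iff₀ hC] at hk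
  obtain ⟨N, hN⟩ := Metric.tendsto_atTop.1 (h k hks) (ε / 3) (by positivity)
  refine ⟨N, fun n hn => ?_⟩
  have h1 := hN n hn
  rw [dist_eq_norm] at h1 ⊢
  have e : B n f - f = B n (f - k) + (B n k - k) - (f - k) := by rw [map_sub]; abel
  have h2 := norm_sub_le (B n (f - k) + (B n k - k)) (f - k)
  have h3 := norm_add_le (B n (f - k)) (B n k - k)
  have h4 := hB n (f - k)
  have h5 : C * ‖f - k‖ ≤ |C| * ‖f - k‖ := by gcongr; exact le_abs_self C
  have h6 : 0 ≤ |C| * ‖f - k‖ := by positivity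
  have h7 := norm_nonneg (f - k)
  rw [e]
  nlinarith

theorem cauchySeq_of_dense {B : ℕ → X →L[ℝ] X} (hB : ∀ n f, ‖B n f‖ ≤ ‖f‖)
    {s : Set X} (hs : Dense s) (h : ∀ f ∈ s, CauchySeq fun n => B n f) (f : X) :
    CauchySeq fun n => B n f := by
  rw [Metric.cauchySeq_iff]
  intro ε hε
  obtain ⟨k, hk, hks⟩ := Metric.dense_iff.1 hs f (ε / 3) (by positivity)
  rw [Metric.mem_ball, dist_comm, dist_eq_norm] at hk
  obtain ⟨N, hN⟩ := Metric.cauchySeq_iff.1 (h k hks) (ε / 3) (by positivity)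
  refine ⟨N, fun m hm n hn => ?_⟩
  have h1 := hN m hm n hn
  rw [dist_eq_norm] at h1 ⊢
  have e : B m f - B n f = B m (f - k) + (B m k - B n k) - B n (f - k) := by
    rw [map_sub, map_sub]; abel
  have h2 := norm_sub_le (B m (f - k) + (B m k - B n k)) (B n (f - k))
  have h3 := norm_add_le (B m (f - k)) (B m k - B n k)
  rw [e]
  linarith [hB m (f - k), hB n (f - k)]

theorem IsResolvent.tendsto_smul_apply (hA : IsMDissipative A) (hR : IsResolvent A R) (f : X) :
    Tendsto (fun n : ℕ => ((n : ℝ) + 1) • R (n + 1) f) atTop (𝓝 f) := by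
  have hpos : ∀ n : ℕ, (0 : ℝ) < n + 1 := fun n => by positivity
  refine tendsto_of_dense (B := fun n : ℕ => ((n : ℝ) + 1) • R (n + 1)) (C := 1)
    (fun n g => ?_) hA.dense (fun g hg => ?_) f
  · rw [smul_apply, norm_smul, Real.norm_of_nonneg (hpos n).le]
    have := mul_le_mul_of_nonneg_left (hR.norm_le hA (hpos n) g) (hpos n).le
    rwa [← mul_assoc, mul_inv_cancel₀ (hpos n).ne'] at this
  · rw [tendsto_iff_norm_sub_tendsto_zero]
    have hg' := A.mem_graph ⟨g, hg⟩
    have h0 : Tendsto (fun n : ℕ => ((n : ℝ) + 1)⁻¹ * ‖A ⟨g, hg⟩‖) atTop (𝓝 0) := by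
      have := (tendsto_one_div_add_atTop_nhds_zero_nat (𝕜 := ℝ)).mul_const ‖A ⟨g, hg⟩‖
      simpa using this
    refine squeeze_zero (fun _ => norm_nonneg _) (fun n => ?_) h0
    rw [smul_apply, hR.smul_apply_sub (hpos n) hg']
    exact hR.norm_le hA (hpos n) _

theorem IsResolvent.tendsto_yosida (hA : IsMDissipative A) (hR : IsResolvent A R) {f h : X}
    (hf : (f, h) ∈ A.graph) :
    Tendsto (fun n : ℕ => yosida R (n + 1) f) atTop (𝓝 h) := by
  refine (hR.tendsto_smul_apply hA h).congr fun n => ?_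
  rw [hR.yosida_apply (by positivity) hf]

variable [CompleteSpace X]

theorem IsResolvent.norm_exp_yosida_le (hA : IsMDissipative A) (hR : IsResolvent A R) (n : ℕ)
    (t : ℝ) (ht : 0 ≤ t) (f : X) :
    ‖NormedSpace.exp (t • yosida R (n + 1)) f‖ ≤ ‖f‖ := by
  have hpos : (0 : ℝ) < n + 1 := by positivity
  have := norm_exp_yosida_apply_le (R (n + 1)) (ContinuousLinearMap.id ℝ X) (l := n + 1)
    (inv_nonneg.2 hpos.le) (hR.norm_le hA hpos) ht f
  have e : t * (((n : ℝ) + 1) ^ 2 * ((n : ℝ) + 1)⁻¹ - (n + 1)) = 0 := by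
    field_simp
    ring
  simpa [e, yosida] using this

theorem IsResolvent.cauchySeq_exp_yosida (hA : IsMDissipative A) (hR : IsResolvent A R)
    {t : ℝ} (ht : 0 ≤ t) (f : X) :
    CauchySeq fun n : ℕ => NormedSpace.exp (t • yosida R (n + 1)) f := by
  refine cauchySeq_of_dense (B := fun n : ℕ => NormedSpace.exp (t • yosida R (n + 1)))
    (fun n f => hR.norm_exp_yosida_le hA n t ht f) hA.dense (fun g hg => ?_) f
  have h1 := (hR.tendsto_yosida hA (A.mem_graph ⟨g, hg⟩)).cauchySeq
  rw [Metric.cauchySeq_iff] at h1 ⊢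
  intro ε hε
  obtain ⟨N, hN⟩ := h1 (ε / (t + 1)) (by positivity)
  refine ⟨N, fun m hm n hn => ?_⟩
  have h2 := hN m hm n hn
  rw [lt_div_iff₀ (by positivity), dist_eq_norm] at h2
  rw [dist_eq_norm]
  refine lt_of_le_of_lt (norm_exp_sub_exp_le (hR.commute_yosida (by positivity) (by positivity))
    (hR.norm_exp_yosida_le hA m) (hR.norm_exp_yosida_le hA n) ht g) ?_
  dsimp only at h2
  nlinarith [norm_nonneg (yosida R (m + 1) g - yosida R (n + 1) g)]

/-- **Lumer–Phillips theorem** for contraction semigroups, with decay estimates for seminorms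
`f ↦ ‖L f‖`. -/
theorem IsMDissipative.exists_semigroup (hA : IsMDissipative A) :
    ∃ S : C0Semigroup X, S.IsGeneratedBy A ∧ (∀ t f, ‖S.op t f‖ ≤ ‖f‖) ∧
      ∀ (L : X →L[ℝ] X) (c : ℝ), 0 ≤ c → (∀ l : ℝ, 0 < l → ∀ f h, (f, h) ∈ A.graph →
          (l + c) * ‖L f‖ ≤ ‖L (l • f - h)‖) →
        ∀ t f, ‖L (S.op t f)‖ ≤ Real.exp (-c * (t : ℝ)) * ‖L f‖ := by
  obtain ⟨R, hR⟩ := hA.exists_resolvent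
  have hE := fun n (t : ℝ≥0) f => hR.norm_exp_yosida_le hA n t t.2 f
  have hlim : ∀ t : ℝ≥0, ∃ T : X →L[ℝ] X, ∀ f,
      Tendsto (fun n : ℕ => NormedSpace.exp ((t : ℝ) • yosida R (n + 1)) f) atTop (𝓝 (T f)) := by
    intro t
    choose T hT using fun f => cauchySeq_tendsto_of_complete (hR.cauchySeq_exp_yosida hA t.2 f)
    exact ⟨LinearMap.mkContinuous
      { toFun := T
        map_add' := fun x y => tendsto_nhds_unique (hT (x + y)) (by
          simpa only [map_add] using (hT x).add (hT y))
        map_smul' := fun c x => tendsto_nhds_unique (hT (c • x)) (by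
          simpa only [map_smul, RingHom.id_apply] using (hT x).const_smul c) } 1
      (fun f => by
        rw [one_mul]
        exact le_of_tendsto (hT f).norm (Eventually.of_forall fun n => hE n t f)), hT⟩
  choose T hT using hlim
  have hTn : ∀ t f, ‖T t f‖ ≤ ‖f‖ := fun t f =>
    le_of_tendsto (hT t f).norm (Eventually.of_forall fun n => hE n t f)
  have hsub : ∀ (t : ℝ≥0) f k k', (k, k') ∈ A.graph →
      ‖T t f - f‖ ≤ 2 * ‖f - k‖ + t * ‖k'‖ := by
    intro t f k k' hk
    have h1 : ‖T t k - k‖ ≤ t * ‖k'‖ := by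
      refine le_of_tendsto ((hT t k).sub_const k).norm (Eventually.of_forall fun n => ?_)
      refine (norm_exp_sub_self_le (hR.norm_exp_yosida_le hA n) t.2 k).trans ?_
      exact mul_le_mul_of_nonneg_left (hR.norm_yosida_le hA (by positivity) hk) t.2
    have e : T t f - f = T t (f - k) + (T t k - k) - (f - k) := by rw [map_sub]; abel
    have h2 := norm_sub_le (T t (f - k) + (T t k - k)) (f - k)
    have h3 := norm_add_le (T t (f - k)) (T t k - k)
    rw [e]
    linarith [hTn t (f - k)]
  have htaylor : ∀ (t : ℝ≥0) f h k k', (f, h) ∈ A.graph → (k, k') ∈ A.graph →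
      ‖T t f - f - (t : ℝ) • h‖ ≤ t * (2 * ‖h - k‖ + t * ‖k'‖) := by
    intro t f h k k' hf hk
    have h0 : Tendsto (fun n : ℕ => ‖yosida R (n + 1) f - h‖) atTop (𝓝 0) :=
      tendsto_iff_norm_sub_tendsto_zero.1 (hR.tendsto_yosida hA hf)
    have h1 : Tendsto (fun n : ℕ => (t : ℝ) *
        (‖yosida R (n + 1) f - h‖ + 2 * ‖h - k‖ + t * ‖k'‖)) atTop
        (𝓝 (t * (0 + 2 * ‖h - k‖ + t * ‖k'‖))) :=
      ((h0.add_const _).add_const _).const_mul _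
    rw [zero_add] at h1
    refine le_of_tendsto_of_tendsto (((hT t f).sub_const f).sub_const _).norm h1
      (Eventually.of_forall fun n => ?_)
    refine (norm_exp_sub_self_sub_le (hR.norm_exp_yosida_le hA n) t.2 f h k).trans ?_
    have := hR.norm_yosida_le hA (l := n + 1) (by positivity) hk
    have ht := mul_le_mul_of_nonneg_left this t.coe_nonneg
    exact mul_le_mul_of_nonneg_left (add_le_add_right ht _) t.coe_nonneg
  let S : C0Semigroup X :=
    { op := T
      op_zero := by
        ext f
        refine tendsto_nhds_unique (hT 0 f) ?_
        simp
      op_add := by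
        intro s t
        ext f
        refine tendsto_nhds_unique (hT (s + t) f) ?_
        have h1 : Tendsto (fun n : ℕ => NormedSpace.exp ((s : ℝ) • yosida R (n + 1))
            (NormedSpace.exp ((t : ℝ) • yosida R (n + 1)) f - T t f)) atTop (𝓝 0) :=
          squeeze_zero_norm (fun n => hE n s _)
            (tendsto_iff_norm_sub_tendsto_zero.1 (hT t f))
        have h2 := h1.add (hT s (T t f))
        rw [zero_add] at h2
        refine h2.congr fun n => ?_
        have hc : Commute ((s : ℝ) • yosida R (n + 1)) ((t : ℝ) • yosida R (n + 1)) :=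
          ((Commute.refl _).smul_left _).smul_right _
        rw [map_sub, sub_add_cancel, NNReal.coe_add, add_smul, exp_add_of_commute_clm hc]
        rfl
      tendsto_zero := by
        intro f
        rw [Metric.tendsto_nhds]
        intro ε hε
        obtain ⟨k, hk, hks⟩ := Metric.dense_iff.1 hA.dense f (ε / 4) (by positivity)
        rw [Metric.mem_ball, dist_comm, dist_eq_norm] at hk
        have h1 : Tendsto (fun t : ℝ≥0 => (t : ℝ) * ‖A ⟨k, hks⟩‖) (𝓝 0) (𝓝 (0 * ‖A ⟨k, hks⟩‖)) :=
          (NNReal.continuous_coe.tendsto 0).mul_const _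
        rw [zero_mul] at h1
        filter_upwards [h1.eventually (gt_mem_nhds (half_pos hε))] with t ht
        rw [dist_eq_norm]
        have := hsub t f k _ (A.mem_graph ⟨k, hks⟩)
        linarith }
  have hgen : ∀ f h, (f, h) ∈ A.graph →
      Tendsto (fun t : ℝ≥0 => (t : ℝ)⁻¹ • (S.op t f - f)) (𝓝[>] 0) (𝓝 h) := by
    intro f h hf
    rw [Metric.tendsto_nhds]
    intro ε hε
    obtain ⟨k, hk, hks⟩ := Metric.dense_iff.1 hA.dense h (ε / 4) (by positivity)
    rw [Metric.mem_ball, dist_comm, dist_eq_norm] at hk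
    have h1 : Tendsto (fun t : ℝ≥0 => (t : ℝ) * ‖A ⟨k, hks⟩‖) (𝓝[>] 0)
        (𝓝 (0 * ‖A ⟨k, hks⟩‖)) :=
      ((NNReal.continuous_coe.tendsto 0).mul_const _).mono_left nhdsWithin_le_nhds
    rw [zero_mul] at h1
    filter_upwards [h1.eventually (gt_mem_nhds (half_pos hε)), self_mem_nhdsWithin] with t ht ht0
    have ht0' : (0 : ℝ) < t := ht0
    have h2 := htaylor t f h k _ hf (A.mem_graph ⟨k, hks⟩)
    have e : (t : ℝ)⁻¹ • (S.op t f - f) - h = (t : ℝ)⁻¹ • (T t f - f - (t : ℝ) • h) := by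
      rw [smul_sub _ _ ((t : ℝ) • h), smul_smul, inv_mul_cancel₀ ht0'.ne', one_smul]
    rw [dist_eq_norm, e, norm_smul, norm_inv, Real.norm_of_nonneg ht0'.le, inv_mul_eq_div,
      div_lt_iff₀' ht0']
    refine h2.trans_lt (mul_lt_mul_of_pos_left ?_ ht0')
    linarith
  refine ⟨S, fun f g => ⟨hgen f g, fun hg => ?_⟩, hTn, fun L c hc h t f => ?_⟩
  · obtain ⟨f', h', hf', he⟩ := hA.surjective 1 one_pos (f - g)
    have h1 := hg.sub (hgen f' h' hf')
    have hzero : f - f' = 0 := by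
      have e1 : g - h' = f - f' := by
        rw [one_smul] at he
        calc g - h' = (f' - h') - (f' - g) := by abel
          _ = f - f' := by rw [he]; abel
      rw [e1] at h1
      have h2 : Tendsto (fun t : ℝ≥0 => ((t : ℝ)⁻¹ • (S.op t f - f) -
          (t : ℝ)⁻¹ • (S.op t f' - f')) - (f - f')) (𝓝[>] 0) (𝓝 0) := by
        simpa using h1.sub_const (f - f')
      have h3 := h2.norm
      rw [norm_zero] at h3
      refine norm_le_zero_iff.1 (ge_of_tendsto h3 ?_)
      filter_upwards [self_mem_nhdsWithin] with t ht0
      have ht0' : (0 : ℝ) < t := ht0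
      have e2 : (1 + (t : ℝ)) • (f - f') = T t (f - f') - (t : ℝ) •
          (((t : ℝ)⁻¹ • (S.op t f - f) - (t : ℝ)⁻¹ • (S.op t f' - f')) - (f - f')) := by
        change _ = T t (f - f') - (t : ℝ) •
          (((t : ℝ)⁻¹ • (T t f - f) - (t : ℝ)⁻¹ • (T t f' - f')) - (f - f'))
        simp only [smul_sub, smul_inv_smul₀ ht0'.ne', map_sub, add_smul, one_smul]
        abel
      have e3 := congrArg norm e2
      rw [norm_smul, Real.norm_of_nonneg (by positivity)] at e3
      have h4 := norm_sub_le (T t (f - f')) ((t : ℝ) •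
          (((t : ℝ)⁻¹ • (S.op t f - f) - (t : ℝ)⁻¹ • (S.op t f' - f')) - (f - f')))
      rw [← e3, norm_smul, Real.norm_of_nonneg ht0'.le] at h4
      have h5 := hTn t (f - f')
      exact le_of_mul_le_mul_left (by linarith) ht0'
    have e4 : f' = f := (sub_eq_zero.1 hzero).symm
    subst e4
    have e5 : h' = g := by
      rw [one_smul] at he
      exact sub_right_injective he
    exact e5 ▸ hf'
  · have hlim : Tendsto (fun n : ℕ => Real.exp ((t : ℝ) * (((n : ℝ) + 1) ^ 2 *
        ((n : ℝ) + 1 + c)⁻¹ - (n + 1))) * ‖L f‖) atTop (𝓝 (Real.exp (-c * t) * ‖L f‖)) := by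
      refine Tendsto.mul_const _ ((Real.continuous_exp.tendsto _).comp ?_)
      have h1 : Tendsto (fun n : ℕ => c ^ 2 * ((n : ℝ) + (1 + c))⁻¹) atTop (𝓝 (c ^ 2 * 0)) :=
        (tendsto_inv_atTop_zero.comp
          (tendsto_atTop_add_const_right _ _ tendsto_natCast_atTop_atTop)).const_mul _
      have h2 := (h1.sub_const c).const_mul (t : ℝ)
      rw [mul_zero, zero_sub, mul_comm] at h2
      refine h2.congr fun n => ?_
      have : (n : ℝ) + 1 + c ≠ 0 := by positivity
      rw [← add_assoc]
      field_simp
      ring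
    refine le_of_tendsto_of_tendsto ((L.continuous.tendsto _).comp (hT t f)).norm hlim
      (Eventually.of_forall fun n => ?_)
    have hpos : (0 : ℝ) < n + 1 := by positivity
    exact norm_exp_yosida_apply_le (R (n + 1)) L (by positivity)
      (hR.norm_comp_le L hpos (by positivity) (h _ hpos)) t.2 f

end LumerPhillips

section Orbits

variable {X : Type*} [NormedAddCommGroup X] [NormedSpace ℝ X]

theorem C0Semigroup.op_add_apply (S : C0Semigroup X) (s t : ℝ≥0) (f : X) :
    S.op (s + t) f = S.op s (S.op t f) := by
  rw [S.op_add]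
  rfl

theorem C0Semigroup.exists_norm_le [CompleteSpace X] (S : C0Semigroup X) :
    ∃ d : ℝ≥0, 0 < d ∧ ∃ M : ℝ, 0 ≤ M ∧ ∀ t ≤ d, ‖S.op t‖ ≤ M := by
  by_contra! hcon
  have h : ∀ n : ℕ, ∃ t ≤ 1 / ((n : ℝ≥0) + 1), (n : ℝ) < ‖S.op t‖ := fun n =>
    hcon _ (by positivity) n (by positivity)
  choose t ht hn using h
  have ht0 : Tendsto t atTop (𝓝 0) :=
    tendsto_of_tendsto_of_tendsto_of_le_of_le tendsto_const_nhds
      (tendsto_one_div_add_atTop_nhds_zero_nat (𝕜 := ℝ≥0)) (fun _ => zero_le) ht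
  obtain ⟨C, hC⟩ := banach_steinhaus (g := fun n => S.op (t n)) fun f => by
    obtain ⟨C, hC⟩ := ((S.tendsto_zero f).comp ht0).norm.bddAbove_range
    exact ⟨C, fun n => hC ⟨n, rfl⟩⟩
  obtain ⟨n, hnC⟩ := exists_nat_gt C
  linarith [hC n, hn n]

theorem C0Semigroup.continuous_orbit [CompleteSpace X] (S : C0Semigroup X) (f : X) :
    Continuous fun t : ℝ≥0 => S.op t f := by
  obtain ⟨d, hd, M, hM, hSM⟩ := S.exists_norm_le
  rw [continuous_iff_continuousAt]
  intro s
  set r := s - d / 2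
  have hbound : ∀ t, r ≤ t → t ≤ s + d / 2 → ‖S.op t‖ ≤ M * ‖S.op r‖ := by
    intro t hrt hts
    have h1 : t - r ≤ d := by
      rw [tsub_le_iff_right]
      refine hts.trans ?_
      have h2 : s ≤ r + d / 2 := by rw [← tsub_le_iff_right]
      calc s + d / 2 ≤ r + d / 2 + d / 2 := by gcongr
        _ = d + r := by rw [add_assoc, add_halves, add_comm]
    calc ‖S.op t‖ = ‖(S.op (t - r)).comp (S.op r)‖ := by rw [← S.op_add, tsub_add_cancel_of_le hrt]
      _ ≤ ‖S.op (t - r)‖ * ‖S.op r‖ := ContinuousLinearMap.opNorm_comp_le _ _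
      _ ≤ M * ‖S.op r‖ := by gcongr; exact hSM _ h1
  have hdist : Tendsto (fun t => nndist t s) (𝓝 s) (𝓝 0) := by
    have : Continuous fun t => nndist t s := by fun_prop
    simpa using this.tendsto s
  have h0 : Tendsto (fun t => M * ‖S.op r‖ * ‖S.op (nndist t s) f - f‖) (𝓝 s) (𝓝 0) := by
    have := (tendsto_iff_norm_sub_tendsto_zero.1 ((S.tendsto_zero f).comp hdist)).const_mul
      (M * ‖S.op r‖)
    simpa using this
  rw [ContinuousAt, tendsto_iff_norm_sub_tendsto_zero]
  refine squeeze_zero' (Eventually.of_forall fun _ => norm_nonneg _) ?_ h0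
  filter_upwards [hdist.eventually (gt_mem_nhds (half_pos hd))] with t ht
  have key : ∀ p q : ℝ≥0, p ≤ q → r ≤ p → p ≤ s + d / 2 →
      ‖S.op q f - S.op p f‖ ≤ M * ‖S.op r‖ * ‖S.op (q - p) f - f‖ := by
    intro p q hpq hrp hps
    have e : S.op q f - S.op p f = S.op p (S.op (q - p) f - f) := by
      rw [map_sub, ← S.op_add_apply, add_tsub_cancel_of_le hpq]
    rw [e]
    exact ((S.op p).le_opNorm _).trans (by gcongr; exact hbound p hrp hps)
  have ht' : |(t : ℝ) - s| < d / 2 := by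
    have h : ((nndist t s : ℝ≥0) : ℝ) < (d / 2 : ℝ≥0) := ht
    rwa [coe_nndist, NNReal.dist_eq] at h
  rw [abs_lt] at ht'
  rcases le_total s t with h | h
  · have e : nndist t s = t - s := by
      ext
      rw [coe_nndist, NNReal.dist_eq, NNReal.coe_sub h, abs_of_nonneg]
      exact sub_nonneg.2 h
    rw [e]
    exact key s t h tsub_le_self le_self_add
  · have e : nndist t s = s - t := by
      ext
      rw [coe_nndist, NNReal.dist_eq, NNReal.coe_sub h, abs_sub_comm, abs_of_nonneg]
      exact sub_nonneg.2 h
    rw [e, norm_sub_rev]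
    refine key t s h ?_ (h.trans le_self_add)
    rw [tsub_le_iff_right, ← NNReal.coe_le_coe]
    push_cast
    linarith

theorem tendsto_toNNReal_sub_nhdsGT (s : ℝ) :
    Tendsto (fun y : ℝ => (y - s).toNNReal) (𝓝[>] s) (𝓝[>] 0) := by
  refine tendsto_nhdsWithin_iff.2 ⟨?_, ?_⟩
  · have h : Continuous fun y : ℝ => (y - s).toNNReal := by fun_prop
    have := h.tendsto s
    rw [sub_self, Real.toNNReal_zero] at this
    exact this.mono_left nhdsWithin_le_nhds
  · filter_upwards [self_mem_nhdsWithin] with y hy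
    exact Real.toNNReal_pos.2 (sub_pos.2 hy)

variable {A : X →ₗ.[ℝ] X} {S : C0Semigroup X}

theorem C0Semigroup.IsGeneratedBy.op_mem_graph (hS : S.IsGeneratedBy A) {f h : X}
    (hf : (f, h) ∈ A.graph) (t : ℝ≥0) : (S.op t f, S.op t h) ∈ A.graph := by
  refine (hS _ _).2 ((((S.op t).continuous.tendsto h).comp ((hS f h).1 hf)).congr fun r => ?_)
  simp only [Function.comp, map_smul, map_sub]
  rw [← S.op_add_apply, ← S.op_add_apply, add_comm]

theorem C0Semigroup.IsGeneratedBy.hasDerivWithinAt (hS : S.IsGeneratedBy A) {f h : X}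
    (hf : (f, h) ∈ A.graph) {s : ℝ} (hs : 0 ≤ s) :
    HasDerivWithinAt (fun y : ℝ => S.op y.toNNReal f) (S.op s.toNNReal h) (Ici s) s := by
  rw [← hasDerivWithinAt_Ioi_iff_Ici, hasDerivWithinAt_iff_tendsto_slope' self_notMem_Ioi]
  refine (((hS _ _).1 (hS.op_mem_graph hf s.toNNReal)).comp
    (tendsto_toNNReal_sub_nhdsGT s)).congr' ?_
  filter_upwards [self_mem_nhdsWithin] with y hy
  have hy' : 0 ≤ y - s := (sub_pos.2 hy).le
  rw [slope_def_module, Function.comp, ← S.op_add_apply, ← Real.toNNReal_add hy' hs,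
    sub_add_cancel, Real.coe_toNNReal _ hy']

theorem C0Semigroup.IsGeneratedBy.op_eq_self [CompleteSpace X] (hS : S.IsGeneratedBy A) {f : X}
    (hf : (f, 0) ∈ A.graph) (t : ℝ≥0) : S.op t f = f := by
  have h := constant_of_has_deriv_right_zero (f := fun y : ℝ => S.op y.toNNReal f) (a := 0)
    (b := t) ((S.continuous_orbit f).comp continuous_real_toNNReal).continuousOn
    (fun s hs => by simpa using hS.hasDerivWithinAt hf hs.1) t (right_mem_Icc.2 t.2)
  simpa [S.op_zero] using h

theorem C0Semigroup.IsGeneratedBy.unique [CompleteSpace X] (hS : S.IsGeneratedBy A)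
    (hSn : ∀ t f, ‖S.op t f‖ ≤ ‖f‖) (hA : Dense (A.domain : Set X)) {S' : C0Semigroup X}
    (hS' : S'.IsGeneratedBy A) : S' = S := by
  have hdom : ∀ f ∈ (A.domain : Set X), ∀ t : ℝ≥0, S'.op t f = S.op t f := by
    intro f hfA t
    have hf := A.mem_graph ⟨f, hfA⟩
    set h := A ⟨f, hfA⟩
    dsimp only at hf
    set v : ℝ → X := fun s => S.op (t - s).toNNReal (S'.op s.toNNReal f) with hv
    have hcont : Continuous v := by
      have hu : Continuous fun s : ℝ => S'.op s.toNNReal f :=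
        (S'.continuous_orbit f).comp continuous_real_toNNReal
      rw [continuous_iff_continuousAt]
      intro s
      have hw : Continuous fun y : ℝ => S.op (t - y).toNNReal (S'.op s.toNNReal f) :=
        (S.continuous_orbit _).comp (by fun_prop)
      have h1 : Tendsto (fun y : ℝ => S.op (t - y).toNNReal
          (S'.op y.toNNReal f - S'.op s.toNNReal f)) (𝓝 s) (𝓝 0) :=
        squeeze_zero_norm (fun y => hSn _ _)
          (tendsto_iff_norm_sub_tendsto_zero.1 (hu.tendsto s))
      have h2 := h1.add (hw.tendsto s)
      rw [zero_add] at h2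
      refine h2.congr fun y => ?_
      rw [map_sub, sub_add_cancel]
    have hderiv : ∀ s ∈ Ico (0 : ℝ) t, HasDerivWithinAt v 0 (Ici s) s := by
      intro s hs
      have hg := hS'.op_mem_graph hf s.toNNReal
      have h1 := hS'.hasDerivWithinAt hf hs.1
      rw [← hasDerivWithinAt_Ioi_iff_Ici, hasDerivWithinAt_iff_tendsto_slope' self_notMem_Ioi]
        at h1 ⊢
      have h2 := ((hS _ _).1 hg).comp (tendsto_toNNReal_sub_nhdsGT s)
      have h3 := (h1.sub h2).norm
      rw [sub_self, norm_zero] at h3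
      refine squeeze_zero_norm' ?_ h3
      filter_upwards [Ioo_mem_nhdsGT hs.2] with y hy
      have hy' : 0 ≤ y - s := (sub_pos.2 hy.1).le
      have hty : 0 ≤ t - y := (sub_pos.2 hy.2).le
      refine le_of_eq_of_le (congrArg norm ?_) (hSn (t - y).toNNReal _)
      have e : S.op ((t : ℝ) - s).toNNReal (S'.op s.toNNReal f) =
          S.op (t - y).toNNReal (S.op (y - s).toNNReal (S'.op s.toNNReal f)) := by
        rw [← S.op_add_apply, ← Real.toNNReal_add hty hy', sub_add_sub_cancel]
      simp only [slope_def_module, hv, e, Function.comp, Real.coe_toNNReal _ hy', map_sub,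
        map_smul, smul_sub]
      abel
    have h4 := constant_of_has_deriv_right_zero hcont.continuousOn hderiv t (right_mem_Icc.2 t.2)
    simpa [hv, S.op_zero, S'.op_zero] using h4
  have hop : S'.op = S.op := by
    funext t
    refine ContinuousLinearMap.coeFn_injective ?_
    exact Continuous.ext_on hA (S'.op t).continuous (S.op t).continuous fun f hf => hdom f hf t
  cases S
  cases S'
  congr

end Orbits

section Graph

variable {a b : ℝ} {ha : a < 0} {hb : 0 < b} {γ : ℝ}

theorem extendLine_apply (f : C(Icc a b, ℝ)) {x : ℝ} (hx : x ∈ Icc a b) :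
    extendLine ha hb f x = f ⟨x, hx⟩ :=
  IccExtend_of_mem _ _ hx

theorem contDiff_two_of_hasDerivAt {F F' F'' : ℝ → ℝ} (hF : ∀ x, HasDerivAt F (F' x) x)
    (hF' : ∀ x, HasDerivAt F' (F'' x) x) (hF'' : Continuous F'') : ContDiff ℝ 2 F := by
  have e : deriv F = F' := funext fun x => (hF x).deriv
  have e' : deriv F' = F'' := funext fun x => (hF' x).deriv
  rw [show (2 : WithTop ℕ∞) = 1 + 1 by norm_num, contDiff_succ_iff_deriv, e, contDiff_one_iff_deriv,
    e']
  exact ⟨fun x => (hF x).differentiableAt, by simp, fun x => (hF' x).differentiableAt, hF''⟩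

theorem iteratedDerivWithin_two_eq {p q : ℝ} (hpq : p < q) {E F F' F'' : ℝ → ℝ}
    (hE : EqOn E F (Icc p q)) (hF : ∀ x, HasDerivAt F (F' x) x)
    (hF' : ∀ x, HasDerivAt F' (F'' x) x) (hF'' : Continuous F'') {x : ℝ} (hx : x ∈ Icc p q) :
    iteratedDerivWithin 2 E (Icc p q) x = F'' x := by
  have e : deriv F = F' := funext fun x => (hF x).deriv
  have e' : deriv F' = F'' := funext fun x => (hF' x).deriv
  rw [iteratedDerivWithin_congr hE hx, iteratedDerivWithin_eq_iteratedDeriv (uniqueDiffOn_Icc hpq)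
    (contDiff_two_of_hasDerivAt hF hF' hF'').contDiffAt hx, iteratedDeriv_succ, iteratedDeriv_one,
    e, e']

/-- Two `C²` functions `F` and `G` on the line satisfying the transmission conditions at `0` and
the boundary conditions can be glued to a member of the domain of `A`. -/
theorem mem_graph_opA_of_hasDerivAt {F F' F'' G G' G'' : ℝ → ℝ}
    (hF : ∀ x, HasDerivAt F (F' x) x) (hF' : ∀ x, HasDerivAt F' (F'' x) x) (hF'' : Continuous F'')
    (hG : ∀ x, HasDerivAt G (G' x) x) (hG' : ∀ x, HasDerivAt G' (G'' x) x) (hG'' : Continuous G'')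
    (hFa : F'' a = 0) (hGb : G'' b = 0) (hjump : G' 0 - F' 0 = 2 * γ * F 0)
    {f h : C(Icc a b, ℝ)}
    (hfF : ∀ x : Icc a b, (x : ℝ) ≤ 0 → f x = F x) (hfG : ∀ x : Icc a b, 0 ≤ (x : ℝ) → f x = G x)
    (hhF : ∀ x : Icc a b, (x : ℝ) ≤ 0 → h x = 1 / 2 * F'' x)
    (hhG : ∀ x : Icc a b, 0 ≤ (x : ℝ) → h x = 1 / 2 * G'' x) :
    (f, h) ∈ (opA ha hb γ).graph := by
  have heF : EqOn (extendLine ha hb f) F (Icc a 0) := fun x hx => by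
    rw [extendLine_apply f ⟨hx.1, hx.2.trans hb.le⟩]
    exact hfF _ hx.2
  have heG : EqOn (extendLine ha hb f) G (Icc 0 b) := fun x hx => by
    rw [extendLine_apply f ⟨ha.le.trans hx.1, hx.2⟩]
    exact hfG _ hx.1
  have hL : ∀ x ∈ Icc a 0, ddL ha hb f x = F'' x := fun x hx =>
    iteratedDerivWithin_two_eq ha heF hF hF' hF'' hx
  have hR : ∀ x ∈ Icc 0 b, ddR ha hb f x = G'' x := fun x hx =>
    iteratedDerivWithin_two_eq hb heG hG hG' hG'' hx
  have h0L : (0 : ℝ) ∈ Icc a 0 := right_mem_Icc.2 ha.le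
  have h0R : (0 : ℝ) ∈ Icc 0 b := left_mem_Icc.2 hb.le
  have hdom : InDomain ha hb γ f :=
    { contDiffL := (contDiff_two_of_hasDerivAt hF hF' hF'').contDiffOn.congr heF
      contDiffR := (contDiff_two_of_hasDerivAt hG hG' hG'').contDiffOn.congr heG
      ddL_left := (hL a (left_mem_Icc.2 ha.le)).trans hFa
      ddR_right := (hR b (right_mem_Icc.2 hb.le)).trans hGb
      dd_zero := by
        have h1 := hhF ⟨0, ha.le, hb.le⟩ le_rfl
        have h2 := hhG ⟨0, ha.le, hb.le⟩ le_rfl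
        rw [hL 0 h0L, hR 0 h0R]
        dsimp only at h1 h2
        linarith
      jump := by
        rw [dR, dL, derivWithin_congr heF (heF h0L), derivWithin_congr heG (heG h0R),
          (hF 0).hasDerivWithinAt.derivWithin (uniqueDiffOn_Icc ha 0 h0L),
          (hG 0).hasDerivWithinAt.derivWithin (uniqueDiffOn_Icc hb 0 h0R),
          hfF ⟨0, ha.le, hb.le⟩ le_rfl]
        exact hjump }
  refine (LinearPMap.mem_graph_iff _).2 ⟨⟨f, hdom⟩, rfl, ?_⟩
  ext x
  change 1 / 2 * ddFun ha hb f x = h x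
  unfold ddFun
  split_ifs with hx
  · rw [hL x ⟨x.2.1, hx⟩, hhF x hx]
  · have hx' := (not_le.1 hx).le
    rw [hR x ⟨hx', x.2.2⟩, hhG x hx']

theorem inDomain_of_mem_graph {f h : C(Icc a b, ℝ)} (hf : (f, h) ∈ (opA ha hb γ).graph) :
    InDomain ha hb γ f ∧ ∀ x : Icc a b, h x = 1 / 2 * ddFun ha hb f x := by
  obtain ⟨⟨y, hy⟩, hyf, hyh⟩ := (LinearPMap.mem_graph_iff _).1 hf
  dsimp only at hyf hyh
  subst hyf
  exact ⟨hy, fun x => (congrArg (fun k : C(Icc a b, ℝ) => k x) hyh).symm⟩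

theorem ddL_eq_of_mem_graph {f h : C(Icc a b, ℝ)} (hf : (f, h) ∈ (opA ha hb γ).graph)
    (x : Icc a b) (hx : (x : ℝ) ≤ 0) : ddL ha hb f x = 2 * h x := by
  have := (inDomain_of_mem_graph hf).2 x
  rw [ddFun, if_pos hx] at this
  linarith

theorem ddR_eq_of_mem_graph {f h : C(Icc a b, ℝ)} (hf : (f, h) ∈ (opA ha hb γ).graph)
    (x : Icc a b) (hx : 0 ≤ (x : ℝ)) : ddR ha hb f x = 2 * h x := by
  obtain ⟨hd, h1⟩ := inDomain_of_mem_graph hf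
  have := h1 x
  rcases hx.eq_or_lt with h0 | h0
  · rw [ddFun, if_pos h0.ge, ← h0, ← hd.dd_zero, h0] at this
    linarith
  · rw [ddFun, if_neg (not_le.2 h0)] at this
    linarith

theorem apply_left_of_mem_graph {f h : C(Icc a b, ℝ)} (hf : (f, h) ∈ (opA ha hb γ).graph) :
    h ⟨a, left_mem_Icc.2 (ha.trans hb).le⟩ = 0 := by
  have := ddL_eq_of_mem_graph hf ⟨a, left_mem_Icc.2 (ha.trans hb).le⟩ ha.le
  rw [(inDomain_of_mem_graph hf).1.ddL_left] at this
  linarith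

theorem apply_right_of_mem_graph {f h : C(Icc a b, ℝ)} (hf : (f, h) ∈ (opA ha hb γ).graph) :
    h ⟨b, right_mem_Icc.2 (ha.trans hb).le⟩ = 0 := by
  have := ddR_eq_of_mem_graph hf ⟨b, right_mem_Icc.2 (ha.trans hb).le⟩ hb.le
  rw [(inDomain_of_mem_graph hf).1.ddR_right] at this
  linarith

theorem hasDerivWithinAt_of_contDiffOn_two {p q : ℝ} (hpq : p < q) {E : ℝ → ℝ}
    (hE : ContDiffOn ℝ 2 E (Icc p q)) {x : ℝ} (hx : x ∈ Icc p q) :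
    HasDerivWithinAt E (derivWithin E (Icc p q) x) (Icc p q) x ∧
      HasDerivWithinAt (derivWithin E (Icc p q)) (iteratedDerivWithin 2 E (Icc p q) x)
        (Icc p q) x := by
  refine ⟨(hE.differentiableOn (by norm_num) x hx).hasDerivWithinAt, ?_⟩
  have h1 : ContDiffOn ℝ 1 (derivWithin E (Icc p q)) (Icc p q) :=
    hE.derivWithin (uniqueDiffOn_Icc hpq) (by norm_num)
  rw [iteratedDerivWithin_succ, iteratedDerivWithin_one]
  exact (h1.differentiableOn (by norm_num) x hx).hasDerivWithinAt

end Graph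

section Maximum

theorem deriv_nonpos_of_max_left {v : ℝ → ℝ} {p q c : ℝ} (hpq : p < q)
    (hv : HasDerivWithinAt v c (Icc p q) p) (hmax : ∀ x ∈ Icc p q, v x ≤ v p) : c ≤ 0 := by
  have h := hv.mono Ioc_subset_Icc_self
  rw [hasDerivWithinAt_iff_tendsto_slope' (by simp), nhdsWithin_Ioc_eq_nhdsGT hpq] at h
  refine le_of_tendsto h ?_
  filter_upwards [Ioc_mem_nhdsGT hpq] with x hx
  rw [slope_def_field]
  exact div_nonpos_of_nonpos_of_nonneg (sub_nonpos.2 (hmax x ⟨hx.1.le, hx.2⟩))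
    (sub_nonneg.2 hx.1.le)

theorem deriv_nonneg_of_max_right {v : ℝ → ℝ} {p q c : ℝ} (hpq : p < q)
    (hv : HasDerivWithinAt v c (Icc p q) q) (hmax : ∀ x ∈ Icc p q, v x ≤ v q) : 0 ≤ c := by
  have h := hv.mono Ico_subset_Icc_self
  rw [hasDerivWithinAt_iff_tendsto_slope' (by simp), nhdsWithin_Ico_eq_nhdsLT hpq] at h
  refine ge_of_tendsto h ?_
  filter_upwards [Ico_mem_nhdsLT hpq] with x hx
  rw [slope_def_field]
  exact div_nonneg_of_nonpos (sub_nonpos.2 (hmax x ⟨hx.1, hx.2.le⟩)) (sub_nonpos.2 hx.2.le)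

/-- One-sided second derivative test at the left end of an interval. -/
theorem second_deriv_nonpos_of_max_left {v v' : ℝ → ℝ} {p q c : ℝ} (hpq : p < q)
    (hv : ∀ x ∈ Icc p q, HasDerivWithinAt v (v' x) (Icc p q) x)
    (hv' : HasDerivWithinAt v' c (Icc p q) p) (h0 : v' p = 0)
    (hmax : ∀ x ∈ Icc p q, v x ≤ v p) : c ≤ 0 := by
  by_contra! hc
  have h := hv'.mono Ioc_subset_Icc_self
  rw [hasDerivWithinAt_iff_tendsto_slope' (by simp), nhdsWithin_Ioc_eq_nhdsGT hpq] at h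
  have hpos : ∀ᶠ x in 𝓝[>] p, x ≤ q ∧ 0 < v' x := by
    filter_upwards [h.eventually (lt_mem_nhds hc), Ioc_mem_nhdsGT hpq] with x hx hxq
    rw [slope_def_field, h0, sub_zero] at hx
    exact ⟨hxq.2, (div_pos_iff_of_pos_right (sub_pos.2 hxq.1)).1 hx⟩
  obtain ⟨r, hr, hrs⟩ := mem_nhdsGT_iff_exists_Ioc_subset.1 hpos
  have hrq : r ≤ q := (hrs (right_mem_Ioc.2 hr)).1
  obtain ⟨x, hx, hxe⟩ := exists_hasDerivAt_eq_slope v v' hr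
    (fun x hx => ((hv x ⟨hx.1, hx.2.trans hrq⟩).continuousWithinAt).mono
      (Icc_subset_Icc_right hrq))
    (fun x hx => (hv x ⟨hx.1.le, hx.2.le.trans hrq⟩).hasDerivAt
      (Icc_mem_nhds hx.1 (hx.2.trans_le hrq)))
  have h1 : 0 < v' x := (hrs ⟨hx.1, hx.2.le⟩).2
  have h2 : (v r - v p) / (r - p) ≤ 0 :=
    div_nonpos_of_nonpos_of_nonneg (sub_nonpos.2 (hmax r ⟨(mem_Ioi.1 hr).le, hrq⟩))
      (sub_nonneg.2 (mem_Ioi.1 hr).le)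
  linarith

/-- Comparison of second derivatives at a point where a function touches `m cos (ε x)` from
below. -/
theorem second_deriv_le_of_touch_cos {E E' E'' : ℝ → ℝ} {p q x₀ m ε : ℝ} (hx₀ : x₀ ∈ Ico p q)
    (hE : ∀ x ∈ Icc p q, HasDerivWithinAt E (E' x) (Icc p q) x)
    (hE' : ∀ x ∈ Icc p q, HasDerivWithinAt E' (E'' x) (Icc p q) x)
    (hle : ∀ x ∈ Icc p q, E x ≤ m * Real.cos (ε * x)) (heq : E x₀ = m * Real.cos (ε * x₀))
    (hp : x₀ = p → E' p + m * (ε * Real.sin (ε * p)) = 0) :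
    E'' x₀ ≤ -ε ^ 2 * E x₀ := by
  have hc : ∀ x, HasDerivAt (fun x => m * Real.cos (ε * x)) (-(m * (ε * Real.sin (ε * x)))) x := by
    intro x
    exact (((hasDerivAt_id' x).const_mul ε).cos.const_mul m).congr_deriv (by ring)
  have hs : ∀ x, HasDerivAt (fun x => m * (ε * Real.sin (ε * x)))
      (m * ε ^ 2 * Real.cos (ε * x)) x := by
    intro x
    exact ((((hasDerivAt_id' x).const_mul ε).sin.const_mul ε).const_mul m).congr_deriv (by ring)
  set v : ℝ → ℝ := fun x => E x - m * Real.cos (ε * x) with hv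
  set v' : ℝ → ℝ := fun x => E' x + m * (ε * Real.sin (ε * x)) with hv'
  have hvd : ∀ x ∈ Icc p q, HasDerivWithinAt v (v' x) (Icc p q) x := fun x hx => by
    have := (hE x hx).sub (hc x).hasDerivWithinAt
    rwa [sub_neg_eq_add] at this
  have hmax : ∀ x ∈ Icc p q, v x ≤ v x₀ := fun x hx => by
    simp only [hv, heq, sub_self]
    linarith [hle x hx]
  have hsub : Icc x₀ q ⊆ Icc p q := Icc_subset_Icc_left hx₀.1
  have h0 : v' x₀ = 0 := by
    rcases hx₀.1.eq_or_lt with h | h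
    · subst h
      exact hp rfl
    · have hn := Icc_mem_nhds h hx₀.2
      exact IsLocalMax.hasDerivAt_eq_zero (f := v)
        (Filter.mem_of_superset hn hmax) ((hvd x₀ ⟨hx₀.1, hx₀.2.le⟩).hasDerivAt hn)
  have key := second_deriv_nonpos_of_max_left hx₀.2
    (fun x hx => (hvd x (hsub hx)).mono hsub)
    ((((hE' x₀ ⟨hx₀.1, hx₀.2.le⟩).add (hs x₀).hasDerivWithinAt)).mono hsub) h0
    (fun x hx => hmax x (hsub hx))
  rw [heq]
  linarith

variable {a b : ℝ} {ha : a < 0} {hb : 0 < b} {γ : ℝ}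

theorem apply_le_of_touch_cos (hγ : 0 ≤ γ) {f h : C(Icc a b, ℝ)}
    (hf : (f, h) ∈ (opA ha hb γ).graph) {m ε : ℝ} (hle : ∀ x : Icc a b, f x ≤ m * Real.cos (ε * x))
    {x₀ : Icc a b} (heq : f x₀ = m * Real.cos (ε * x₀)) (hpos : 0 ≤ f x₀) (hxa : a < x₀)
    (hxb : x₀ < b) : h x₀ ≤ -(ε ^ 2 / 2) * f x₀ := by
  obtain ⟨hd, -⟩ := inDomain_of_mem_graph hf
  have h1 := fun x hx => hasDerivWithinAt_of_contDiffOn_two (x := x) ha hd.contDiffL hx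
  have h2 := fun x hx => hasDerivWithinAt_of_contDiffOn_two (x := x) hb hd.contDiffR hx
  have hleL : ∀ x ∈ Icc a 0, extendLine ha hb f x ≤ m * Real.cos (ε * x) := fun x hx => by
    rw [extendLine_apply f ⟨hx.1, hx.2.trans hb.le⟩]
    exact hle _
  have hleR : ∀ x ∈ Icc 0 b, extendLine ha hb f x ≤ m * Real.cos (ε * x) := fun x hx => by
    rw [extendLine_apply f ⟨ha.le.trans hx.1, hx.2⟩]
    exact hle _
  have hext : extendLine ha hb f x₀ = f x₀ := extendLine_apply f x₀.2
  rcases lt_or_ge (x₀ : ℝ) 0 with hx | hx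
  · have key := second_deriv_le_of_touch_cos (E := extendLine ha hb f) (E' := dL ha hb f)
      (E'' := ddL ha hb f) ⟨hxa.le, hx⟩ (fun x hx => (h1 x hx).1) (fun x hx => (h1 x hx).2) hleL
      (hext.trans heq) (fun h => absurd h hxa.ne')
    rw [ddL_eq_of_mem_graph hf x₀ hx.le, hext] at key
    linarith
  · have key := second_deriv_le_of_touch_cos (E := extendLine ha hb f) (E' := dR ha hb f)
      (E'' := ddR ha hb f) ⟨hx, hxb⟩ (fun x hx => (h2 x hx).1) (fun x hx => (h2 x hx).2) hleR
      (hext.trans heq) (fun h0 => by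
        have hc : HasDerivAt (fun x => m * Real.cos (ε * x)) 0 0 := by
          exact (((hasDerivAt_id' (0 : ℝ)).const_mul ε).cos.const_mul m).congr_deriv (by simp)
        have he0 : extendLine ha hb f 0 = m * Real.cos (ε * 0) := by
          rw [← h0, hext, heq]
        have hL := deriv_nonneg_of_max_right ha
          ((h1 0 (right_mem_Icc.2 ha.le)).1.sub hc.hasDerivWithinAt) (fun x hx => by
            have := hleL x hx
            simp only [Pi.sub_apply, he0, sub_self]
            linarith)
        have hR := deriv_nonpos_of_max_left hb
          ((h2 0 (left_mem_Icc.2 hb.le)).1.sub hc.hasDerivWithinAt) (fun x hx => by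
            have := hleR x hx
            simp only [Pi.sub_apply, he0, sub_self]
            linarith)
        have hj := hd.jump
        have hf0 : f ⟨0, ha.le, hb.le⟩ = f x₀ := congrArg f (Subtype.ext h0.symm)
        rw [hf0] at hj
        have : 0 ≤ 2 * γ * f x₀ := by positivity
        rw [sub_zero] at hL hR
        unfold dL dR at *
        rw [mul_zero, Real.sin_zero, mul_zero, mul_zero, add_zero]
        linarith)
    rw [ddR_eq_of_mem_graph hf x₀ hx, hext] at key
    linarith

/-- Maximum principle for the resolvent equation, relative to the weight `cos (ε x)`. -/
theorem le_of_resolvent_le (hγ : 0 ≤ γ) {f h : C(Icc a b, ℝ)}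
    (hf : (f, h) ∈ (opA ha hb γ).graph) {l ε M : ℝ} (hl : 0 < l)
    (hcos : ∀ x ∈ Icc a b, 0 < Real.cos (ε * x))
    (hbd : ε = 0 ∨ f ⟨a, left_mem_Icc.2 (ha.trans hb).le⟩ = 0 ∧
      f ⟨b, right_mem_Icc.2 (ha.trans hb).le⟩ = 0)
    (hM : 0 ≤ M) (hle : ∀ x : Icc a b, l * f x - h x ≤ M * Real.cos (ε * x)) (x : Icc a b) :
    f x ≤ M / (l + ε ^ 2 / 2) * Real.cos (ε * x) := by
  have hne : (univ : Set (Icc a b)).Nonempty := ⟨x, mem_univ x⟩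
  have hcont : Continuous fun x : Icc a b => f x / Real.cos (ε * x) :=
    f.continuous.div (by fun_prop) fun x => (hcos x x.2).ne'
  obtain ⟨x₀, -, hx₀⟩ := isCompact_univ.exists_isMaxOn hne hcont.continuousOn
  set m := f x₀ / Real.cos (ε * x₀) with hm
  have hfm : ∀ y : Icc a b, f y ≤ m * Real.cos (ε * y) := fun y =>
    (div_le_iff₀ (hcos y y.2)).1 (hx₀ (mem_univ y))
  have heq : f x₀ = m * Real.cos (ε * x₀) := (div_mul_cancel₀ _ (hcos _ x₀.2).ne').symm
  have hden : 0 < l + ε ^ 2 / 2 := by positivity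
  refine (hfm x).trans (mul_le_mul_of_nonneg_right ?_ (hcos x x.2).le)
  rcases le_or_gt (f x₀) 0 with hneg | hpos
  · exact (div_nonpos_of_nonpos_of_nonneg hneg (hcos _ x₀.2).le).trans (by positivity)
  have hh : h x₀ ≤ -(ε ^ 2 / 2) * f x₀ := by
    have hend : (h x₀ = 0 ∧ (ε = 0 ∨ f x₀ = 0)) → h x₀ ≤ -(ε ^ 2 / 2) * f x₀ := by
      rintro ⟨h1, h2 | h2⟩ <;> simp [h1, h2]
    rcases x₀.2.1.eq_or_lt with hxa | hxa
    · have e : x₀ = ⟨a, left_mem_Icc.2 (ha.trans hb).le⟩ := Subtype.ext hxa.symm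
      exact hend ⟨e ▸ apply_left_of_mem_graph hf, hbd.imp id fun h => e ▸ h.1⟩
    rcases x₀.2.2.eq_or_lt with hxb | hxb
    · have e : x₀ = ⟨b, right_mem_Icc.2 (ha.trans hb).le⟩ := Subtype.ext hxb
      exact hend ⟨e ▸ apply_right_of_mem_graph hf, hbd.imp id fun h => e ▸ h.2⟩
    exact apply_le_of_touch_cos hγ hf hfm heq hpos.le hxa hxb
  rw [hm, div_le_div_iff₀ (hcos _ x₀.2) hden]
  linarith [hle x₀]

theorem abs_le_of_resolvent_le (hγ : 0 ≤ γ) {f h : C(Icc a b, ℝ)}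
    (hf : (f, h) ∈ (opA ha hb γ).graph) {l ε M : ℝ} (hl : 0 < l)
    (hcos : ∀ x ∈ Icc a b, 0 < Real.cos (ε * x))
    (hbd : ε = 0 ∨ f ⟨a, left_mem_Icc.2 (ha.trans hb).le⟩ = 0 ∧
      f ⟨b, right_mem_Icc.2 (ha.trans hb).le⟩ = 0)
    (hM : 0 ≤ M) (hle : ∀ x : Icc a b, |l * f x - h x| ≤ M * Real.cos (ε * x)) (x : Icc a b) :
    |f x| ≤ M / (l + ε ^ 2 / 2) * Real.cos (ε * x) := by
  refine abs_le'.2 ⟨le_of_resolvent_le hγ hf hl hcos hbd hM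
    (fun y => (le_abs_self _).trans (hle y)) x, ?_⟩
  have hneg : (-f, -h) ∈ (opA ha hb γ).graph := (opA ha hb γ).graph.neg_mem hf
  refine le_of_resolvent_le hγ hneg hl hcos (hbd.imp id fun h => ?_) hM (fun y => ?_) x
  · simpa using h
  · refine le_trans ?_ ((neg_le_abs _).trans (hle y))
    simp only [ContinuousMap.neg_apply]
    linarith

theorem dissipative_opA (hγ : 0 ≤ γ) {l : ℝ} (hl : 0 < l) {f h : C(Icc a b, ℝ)}
    (hf : (f, h) ∈ (opA ha hb γ).graph) : l * ‖f‖ ≤ ‖l • f - h‖ := by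
  rw [← le_div_iff₀' hl, ContinuousMap.norm_le _ (by positivity)]
  intro x
  have := abs_le_of_resolvent_le hγ hf (ε := 0) hl (by simp) (Or.inl rfl)
    (norm_nonneg (l • f - h)) (fun y => by simpa using (l • f - h).norm_coe_le_norm y) x
  simpa using this

end Maximum

theorem exists_glue {a b : ℝ} {F G : ℝ → ℝ} (hF : Continuous F) (hG : Continuous G)
    (h0 : F 0 = G 0) : ∃ f : C(Icc a b, ℝ), (∀ x : Icc a b, (x : ℝ) ≤ 0 → f x = F x) ∧
      ∀ x : Icc a b, 0 ≤ (x : ℝ) → f x = G x := by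
  refine ⟨⟨fun x => if (x : ℝ) ≤ 0 then F x else G x, ?_⟩, fun x hx => if_pos hx, fun x hx => ?_⟩
  · refine continuous_if_le continuous_subtype_val continuous_const
      (hF.comp continuous_subtype_val).continuousOn (hG.comp continuous_subtype_val).continuousOn ?_
    intro x hx
    rw [hx, h0]
  · change (if (x : ℝ) ≤ 0 then F x else G x) = G x
    split_ifs with h
    · rw [le_antisymm h hx, h0]
    · rfl

section Resolvent

/-- Solutions of `F'' = k² F - 2 g` by variation of constants. -/
theorem exists_solution_ode {g : ℝ → ℝ} (hg : Continuous g) {k : ℝ} (hk : k ≠ 0) :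
    ∃ u : ℝ → ℝ, u 0 = 0 ∧ ∀ c d : ℝ, ∃ F' : ℝ → ℝ, F' 0 = d ∧
      (∀ x, HasDerivAt (fun x => u x + c * Real.cosh (k * x) + d * Real.sinh (k * x) / k)
        (F' x) x) ∧
      ∀ x, HasDerivAt F'
        (k ^ 2 * (u x + c * Real.cosh (k * x) + d * Real.sinh (k * x) / k) - 2 * g x) x := by
  have hC : ∀ x, HasDerivAt (fun x => ∫ s in (0 : ℝ)..x, Real.cosh (k * s) * g s)
      (Real.cosh (k * x) * g x) x := fun x =>
    (show Continuous fun s => Real.cosh (k * s) * g s by fun_prop).integral_hasStrictDerivAt 0 x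
      |>.hasDerivAt
  have hS : ∀ x, HasDerivAt (fun x => ∫ s in (0 : ℝ)..x, Real.sinh (k * s) * g s)
      (Real.sinh (k * x) * g x) x := fun x =>
    (show Continuous fun s => Real.sinh (k * s) * g s by fun_prop).integral_hasStrictDerivAt 0 x
      |>.hasDerivAt
  set C := fun x => ∫ s in (0 : ℝ)..x, Real.cosh (k * s) * g s with hCdef
  set S := fun x => ∫ s in (0 : ℝ)..x, Real.sinh (k * s) * g s with hSdef
  have hch : ∀ x, HasDerivAt (fun x => Real.cosh (k * x)) (k * Real.sinh (k * x)) x := fun x =>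
    ((hasDerivAt_id' x).const_mul k).cosh.congr_deriv (by ring)
  have hsh : ∀ x, HasDerivAt (fun x => Real.sinh (k * x)) (k * Real.cosh (k * x)) x := fun x =>
    ((hasDerivAt_id' x).const_mul k).sinh.congr_deriv (by ring)
  refine ⟨fun x => -(2 / k) * (Real.sinh (k * x) * C x - Real.cosh (k * x) * S x), ?_,
    fun c d => ⟨fun x => -2 * (Real.cosh (k * x) * C x - Real.sinh (k * x) * S x) +
      c * (k * Real.sinh (k * x)) + d * Real.cosh (k * x), ?_, fun x => ?_, fun x => ?_⟩⟩
  · simp [hCdef, hSdef]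
  · simp [hCdef, hSdef]
  · refine ((((((hsh x).mul (hC x)).sub ((hch x).mul (hS x))).const_mul (-(2 / k))).add
      ((hch x).const_mul c)).add (((hsh x).const_mul d).div_const k)).congr_deriv ?_
    field_simp
    ring
  · refine ((((((hch x).mul (hC x)).sub ((hsh x).mul (hS x))).const_mul (-2)).add
      (((hsh x).const_mul k).const_mul c)).add ((hch x).const_mul d)).congr_deriv ?_
    have := Real.cosh_sq (k * x)
    field_simp
    linear_combination (-2 * g x) * this

variable {a b : ℝ} {ha : a < 0} {hb : 0 < b} {γ : ℝ}

theorem surjective_opA (hγ : 0 ≤ γ) {l : ℝ} (hl : 0 < l) (g : C(Icc a b, ℝ)) :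
    ∃ f h, (f, h) ∈ (opA ha hb γ).graph ∧ l • f - h = g := by
  set k := Real.sqrt (2 * l)
  have hk : 0 < k := Real.sqrt_pos.2 (by positivity)
  have hk2 : k ^ 2 = 2 * l := Real.sq_sqrt (by positivity)
  set E := extendLine ha hb g
  have hE : Continuous E := g.continuous.Icc_extend'
  obtain ⟨u, hu0, hu⟩ := exists_solution_ode hE hk.ne'
  have hsb : 0 < Real.sinh (k * b) := Real.sinh_pos_iff.2 (by positivity)
  have hsa : Real.sinh (k * a) < 0 := Real.sinh_neg_iff.2 (mul_neg_of_pos_of_neg hk ha)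
  set D := 2 * γ + k * Real.cosh (k * b) / Real.sinh (k * b) -
    k * Real.cosh (k * a) / Real.sinh (k * a) with hDdef
  have hD : 0 < D := by
    have h1 : 0 < k * Real.cosh (k * b) / Real.sinh (k * b) :=
      div_pos (mul_pos hk (Real.cosh_pos _)) hsb
    have h2 : k * Real.cosh (k * a) / Real.sinh (k * a) < 0 :=
      div_neg_of_pos_of_neg (mul_pos hk (Real.cosh_pos _)) hsa
    rw [hDdef]
    linarith
  set c := k * ((E b / l - u b) / Real.sinh (k * b) - (E a / l - u a) / Real.sinh (k * a)) / D
    with hc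
  have hcD : c * D =
      k * ((E b / l - u b) / Real.sinh (k * b) - (E a / l - u a) / Real.sinh (k * a)) :=
    div_mul_cancel₀ _ hD.ne'
  set dR := k * (E b / l - u b - c * Real.cosh (k * b)) / Real.sinh (k * b) with hdR
  set dL := k * (E a / l - u a - c * Real.cosh (k * a)) / Real.sinh (k * a) with hdL
  obtain ⟨F', hF'0, hF, hF'⟩ := hu c dL
  obtain ⟨G', hG'0, hG, hG'⟩ := hu c dR
  have hFc := continuous_iff_continuousAt.2 fun x => (hF x).continuousAt
  have hGc := continuous_iff_continuousAt.2 fun x => (hG x).continuousAt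
  obtain ⟨f, hfF, hfG⟩ := exists_glue (a := a) (b := b) hFc hGc (by simp)
  have hEx : ∀ x : Icc a b, E x = g x := fun x => extendLine_apply g x.2
  refine ⟨f, l • f - g, ?_, sub_sub_cancel _ _⟩
  refine mem_graph_opA_of_hasDerivAt hF hF' (by fun_prop) hG hG' (by fun_prop) ?_ ?_ ?_ hfF hfG
    (fun x hx => ?_) (fun x hx => ?_)
  · have hsa0 := hsa.ne
    rw [hdL, hk2]
    field_simp
    ring
  · rw [hdR, hk2]
    field_simp
    ring
  · rw [hF'0, hG'0, hu0]
    have : dR - dL = k * ((E b / l - u b) / Real.sinh (k * b) -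
        (E a / l - u a) / Real.sinh (k * a)) - c * (D - 2 * γ) := by
      rw [hdR, hdL, hDdef]
      ring
    rw [this, ← hcD]
    simp
    ring
  · simp only [ContinuousMap.sub_apply, ContinuousMap.smul_apply, smul_eq_mul, hfF x hx, hk2, hEx]
    ring
  · simp only [ContinuousMap.sub_apply, ContinuousMap.smul_apply, smul_eq_mul, hfG x hx, hk2, hEx]
    ring

end Resolvent

section Density

/-- A uniformly small function with prescribed first derivative at `0` and second derivative at
`q`, and with vanishing second derivative at `0`. -/
theorem exists_small_correction {q : ℝ} (hq : q ≠ 0) (α δ : ℝ) {ε : ℝ} (hε : 0 < ε) :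
    ∃ w w' w'' : ℝ → ℝ, (∀ x, HasDerivAt w (w' x) x) ∧ (∀ x, HasDerivAt w' (w'' x) x) ∧
      Continuous w'' ∧ w 0 = 0 ∧ w' 0 = δ ∧ w'' 0 = 0 ∧ w'' q = α ∧
      ∀ x, |x| ≤ |q| → |w x| ≤ ε := by
  obtain ⟨m, hm⟩ := exists_nat_gt ((|α| * q ^ 2 + |δ| * |q|) / ε)
  rw [div_lt_iff₀ hε] at hm
  set ω := ((m : ℝ) + 3) * Real.pi / q with hω
  have hπ := Real.pi_pos
  have hω0 : ω ≠ 0 := by positivity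
  have hlin : ∀ x, HasDerivAt (fun x : ℝ => x / q) (1 / q) x := fun x =>
    (hasDerivAt_id' x).div_const q
  have hωx : ∀ x, HasDerivAt (fun x : ℝ => ω * x) ω x := fun x =>
    ((hasDerivAt_id' x).const_mul ω).congr_deriv (mul_one ω)
  refine ⟨fun x => α * q ^ 2 / ((m + 3) * (m + 2)) * (x / q) ^ (m + 3) + δ / ω * Real.sin (ω * x),
    fun x => α * q / (m + 2) * (x / q) ^ (m + 2) + δ * Real.cos (ω * x),
    fun x => α * (x / q) ^ (m + 1) - δ * ω * Real.sin (ω * x), fun x => ?_, fun x => ?_,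
    by fun_prop, by simp, by simp, by simp, ?_, fun x hx => ?_⟩
  · refine ((((hlin x).pow (m + 3)).const_mul _).add ((hωx x).sin.const_mul _)).congr_deriv ?_
    simp only [Nat.add_succ_sub_one]
    push_cast
    field_simp
  · refine ((((hlin x).pow (m + 2)).const_mul _).add ((hωx x).cos.const_mul _)).congr_deriv ?_
    simp only [Nat.add_succ_sub_one]
    push_cast
    field_simp
    ring
  · have h1 : ω * q = ((m + 3 : ℕ) : ℝ) * Real.pi := by
      rw [hω]
      push_cast
      field_simp
    simp only [h1, Real.sin_nat_mul_pi, div_self hq, one_pow, mul_one, mul_zero, sub_zero]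
  · have h1 : |x / q| ^ (m + 3) ≤ 1 :=
      pow_le_one₀ (abs_nonneg _) (by rw [abs_div]; exact div_le_one_of_le₀ hx (abs_nonneg _))
    have h2 : |α * q ^ 2 / ((m + 3) * (m + 2)) * (x / q) ^ (m + 3)| ≤ |α| * q ^ 2 / (m + 1) := by
      rw [abs_mul, abs_pow, abs_div, abs_mul, abs_of_nonneg (sq_nonneg q),
        abs_of_pos (show (0 : ℝ) < (m + 3) * (m + 2) by positivity)]
      refine (mul_le_of_le_one_right (by positivity) h1).trans ?_
      gcongr
      nlinarith [(Nat.cast_nonneg m : (0 : ℝ) ≤ m)]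
    have h3 : |δ / ω * Real.sin (ω * x)| ≤ |δ| * |q| / (m + 1) := by
      rw [abs_mul, abs_div]
      refine (mul_le_of_le_one_right (by positivity) (Real.abs_sin_le_one _)).trans ?_
      rw [hω, abs_div, abs_of_pos (show (0 : ℝ) < (m + 3) * Real.pi by positivity),
        div_div_eq_mul_div]
      gcongr
      nlinarith [(Nat.cast_nonneg m : (0 : ℝ) ≤ m), Real.pi_gt_three]
    refine (abs_add_le _ _).trans ((add_le_add h2 h3).trans ?_)
    rw [← add_div, div_le_iff₀ (by positivity)]
    linarith

variable {a b : ℝ} {ha : a < 0} {hb : 0 < b} {γ : ℝ}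

theorem dense_domain_opA : Dense ((opA ha hb γ).domain : Set C(Icc a b, ℝ)) := by
  refine Metric.dense_iff.2 fun f ε hε => ?_
  obtain ⟨p, hp⟩ := exists_polynomial_near_continuousMap a b f (ε / 2) (by positivity)
  obtain ⟨w, w', w'', hw, hw', hwc, hw0, hw'0, hw''0, hwa, hwle⟩ := exists_small_correction
    ha.ne (-p.derivative.derivative.eval a) 0 (show 0 < ε / 4 by positivity)
  obtain ⟨z, z', z'', hz, hz', hzc, hz0, hz'0, hz''0, hzb, hzle⟩ := exists_small_correction
    hb.ne' (-p.derivative.derivative.eval b) (2 * γ * p.eval 0) (show 0 < ε / 4 by positivity)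
  have hF := fun x => (p.hasDerivAt x).add (hw x)
  have hG := fun x => (p.hasDerivAt x).add (hz x)
  have hF' := fun x => (p.derivative.hasDerivAt x).add (hw' x)
  have hG' := fun x => (p.derivative.hasDerivAt x).add (hz' x)
  have hF'' : Continuous fun x => p.derivative.derivative.eval x + w'' x :=
    p.derivative.derivative.continuous.add hwc
  have hG'' : Continuous fun x => p.derivative.derivative.eval x + z'' x :=
    p.derivative.derivative.continuous.add hzc
  obtain ⟨g, hgF, hgG⟩ := exists_glue (a := a) (b := b)
    (continuous_iff_continuousAt.2 fun x => (hF x).continuousAt)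
    (continuous_iff_continuousAt.2 fun x => (hG x).continuousAt) (by simp [hw0, hz0])
  obtain ⟨h, hhF, hhG⟩ := exists_glue (a := a) (b := b) (hF''.const_mul (1 / 2))
    (hG''.const_mul (1 / 2)) (by simp [hw''0, hz''0])
  have hmem : (g, h) ∈ (opA ha hb γ).graph :=
    mem_graph_opA_of_hasDerivAt hF hF' hF'' hG hG' hG'' (by simp [hwa]) (by simp [hzb])
      (by simp [hw'0, hz'0, hw0]) hgF hgG hhF hhG
  refine ⟨g, ?_, LinearPMap.mem_domain_of_mem_graph hmem⟩
  rw [Metric.mem_ball, dist_eq_norm]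
  have h1 : ‖g - p.toContinuousMapOn (Icc a b)‖ ≤ ε / 4 := by
    rw [ContinuousMap.norm_le _ (by positivity)]
    intro x
    rw [ContinuousMap.sub_apply, Real.norm_eq_abs]
    rcases le_total (x : ℝ) 0 with hx | hx
    · rw [hgF x hx]
      simpa using hwle x (by rw [abs_of_nonpos hx, abs_of_neg ha]; linarith [x.2.1])
    · rw [hgG x hx]
      simpa using hzle x (by rw [abs_of_nonneg hx, abs_of_pos hb]; exact x.2.2)
  have h2 := norm_add_le (g - p.toContinuousMapOn (Icc a b)) (p.toContinuousMapOn (Icc a b) - f)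
  rw [sub_add_sub_cancel] at h2
  linarith

theorem isMDissipative_opA (hγ : 0 ≤ γ) : IsMDissipative (opA ha hb γ) where
  dissipative _ hl _ _ hf := dissipative_opA hγ hl hf
  surjective _ hl g := surjective_opA hγ hl g
  dense := dense_domain_opA

end Density

section Projection

variable {a b : ℝ} {ha : a < 0} {hb : 0 < b} {γ : ℝ}

theorem denominator_pos (ha : a < 0) (hb : 0 < b) (hγ : 0 ≤ γ) :
    0 < b - a - 2 * γ * a * b := by
  have : 0 ≤ γ * (-a * b) := by have := neg_pos.2 ha; positivity
  linarith

theorem ellStar_left (ha : a < 0) (hb : 0 < b) (hγ : 0 ≤ γ) :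
    ellStar a b γ ⟨a, left_mem_Icc.2 (ha.trans hb).le⟩ = 1 := by
  change (b - a - 2 * γ * b * (a * (if a ≤ 0 then 1 else 0))) / (b - a - 2 * γ * a * b) = 1
  rw [if_pos ha.le, div_eq_one_iff_eq (denominator_pos ha hb hγ).ne']
  ring

theorem ellStar_right (ha : a < 0) (hb : 0 < b) :
    ellStar a b γ ⟨b, right_mem_Icc.2 (ha.trans hb).le⟩ = 0 := by
  change (b - b - 2 * γ * b * (b * (if b ≤ 0 then 1 else 0))) / (b - a - 2 * γ * a * b) = 0
  rw [if_neg (not_le.2 hb)]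
  simp

theorem kStar_left (ha : a < 0) (hb : 0 < b) :
    kStar a b γ ⟨a, left_mem_Icc.2 (ha.trans hb).le⟩ = 0 := by
  change (a - a - 2 * γ * a * (a * (if 0 ≤ a then 1 else 0))) / (b - a - 2 * γ * a * b) = 0
  rw [if_neg (not_le.2 ha)]
  simp

theorem kStar_right (ha : a < 0) (hb : 0 < b) (hγ : 0 ≤ γ) :
    kStar a b γ ⟨b, right_mem_Icc.2 (ha.trans hb).le⟩ = 1 := by
  change (b - a - 2 * γ * a * (b * (if 0 ≤ b then 1 else 0))) / (b - a - 2 * γ * a * b) = 1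
  rw [if_pos hb.le, div_eq_one_iff_eq (denominator_pos ha hb hγ).ne']
  ring

theorem hasDerivAt_affine_div (c d D x : ℝ) :
    HasDerivAt (fun x : ℝ => (c + d * x) / D) (d / D) x :=
  ((((hasDerivAt_id' x).const_mul d).const_add c).div_const D).congr_deriv (by rw [mul_one])

theorem ellStar_mem_graph : (ellStar a b γ, 0) ∈ (opA ha hb γ).graph := by
  refine mem_graph_opA_of_hasDerivAt
    (hasDerivAt_affine_div b (-1 - 2 * γ * b) (b - a - 2 * γ * a * b))
    (fun x => hasDerivAt_const x _) continuous_const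
    (hasDerivAt_affine_div b (-1) (b - a - 2 * γ * a * b))
    (fun x => hasDerivAt_const x _) continuous_const rfl rfl (by ring) (fun x hx => ?_)
    (fun x hx => ?_) (by simp) (by simp)
  · change (b - x - 2 * γ * b * (x * (if (x : ℝ) ≤ 0 then 1 else 0))) / _ = _
    rw [if_pos hx]
    ring
  · change (b - x - 2 * γ * b * (x * (if (x : ℝ) ≤ 0 then 1 else 0))) / _ = _
    split_ifs with h
    · rw [le_antisymm h hx]
      ring
    · ring

theorem kStar_mem_graph : (kStar a b γ, 0) ∈ (opA ha hb γ).graph := by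
  refine mem_graph_opA_of_hasDerivAt
    (hasDerivAt_affine_div (-a) 1 (b - a - 2 * γ * a * b))
    (fun x => hasDerivAt_const x _) continuous_const
    (hasDerivAt_affine_div (-a) (1 - 2 * γ * a) (b - a - 2 * γ * a * b))
    (fun x => hasDerivAt_const x _) continuous_const rfl rfl (by ring) (fun x hx => ?_)
    (fun x hx => ?_) (by simp) (by simp)
  · change (x - a - 2 * γ * a * (x * (if 0 ≤ (x : ℝ) then 1 else 0))) / _ = _
    split_ifs with h
    · rw [le_antisymm hx h]
      ring
    · ring
  · change (x - a - 2 * γ * a * (x * (if 0 ≤ (x : ℝ) then 1 else 0))) / _ = _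
    rw [if_pos hx]
    ring

theorem opP_mem_graph (f : C(Icc a b, ℝ)) : (opP ha hb γ f, 0) ∈ (opA ha hb γ).graph := by
  have h := (opA ha hb γ).graph.add_mem
    ((opA ha hb γ).graph.smul_mem (f ⟨a, left_mem_Icc.2 (ha.trans hb).le⟩) ellStar_mem_graph)
    ((opA ha hb γ).graph.smul_mem (f ⟨b, right_mem_Icc.2 (ha.trans hb).le⟩) kStar_mem_graph)
  simpa [opP_apply] using h

theorem opP_apply_left (hγ : 0 ≤ γ) (f : C(Icc a b, ℝ)) :
    opP ha hb γ f ⟨a, left_mem_Icc.2 (ha.trans hb).le⟩ =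
      f ⟨a, left_mem_Icc.2 (ha.trans hb).le⟩ := by
  simp [opP_apply, ellStar_left ha hb hγ, kStar_left ha hb]

theorem opP_apply_right (hγ : 0 ≤ γ) (f : C(Icc a b, ℝ)) :
    opP ha hb γ f ⟨b, right_mem_Icc.2 (ha.trans hb).le⟩ =
      f ⟨b, right_mem_Icc.2 (ha.trans hb).le⟩ := by
  simp [opP_apply, ellStar_right ha hb, kStar_right ha hb hγ]

theorem opP_opP (hγ : 0 ≤ γ) (f : C(Icc a b, ℝ)) :
    opP ha hb γ (opP ha hb γ f) = opP ha hb γ f := by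
  rw [opP_apply _ _ _ (opP ha hb γ f), opP_apply_left hγ, opP_apply_right hγ, ← opP_apply]

theorem opP_eq_zero_of_mem_graph {f h : C(Icc a b, ℝ)} (hf : (f, h) ∈ (opA ha hb γ).graph) :
    opP ha hb γ h = 0 := by
  rw [opP_apply, apply_left_of_mem_graph hf, apply_right_of_mem_graph hf]
  simp

theorem range_opP (hγ : 0 ≤ γ) :
    (opP ha hb γ).range = Submodule.span ℝ {ellStar a b γ, kStar a b γ} := by
  apply le_antisymm
  · rintro _ ⟨f, rfl⟩
    exact Submodule.mem_span_pair.2 ⟨_, _, rfl⟩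
  · rw [Submodule.span_le]
    rintro f (rfl | rfl)
    · exact ⟨ellStar a b γ, by
        change opP ha hb γ _ = _
        simp [opP_apply, ellStar_left ha hb hγ, ellStar_right ha hb]⟩
    · exact ⟨kStar a b γ, by
        change opP ha hb γ _ = _
        simp [opP_apply, kStar_left ha hb, kStar_right ha hb hγ]⟩

end Projection

section Decay

variable {a b : ℝ} {ha : a < 0} {hb : 0 < b} {γ : ℝ}

theorem cos_pos_of_mem_Icc (ha : a < 0) (hb : 0 < b) {x : ℝ} (hx : x ∈ Icc a b) :
    0 < Real.cos (1 / (b - a) * x) := by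
  have hba : 0 < b - a := by linarith
  have h1 : 1 / (b - a) * x ≤ 1 := by
    rw [one_div_mul_eq_div, div_le_one hba]
    linarith [hx.2]
  have h2 : -1 ≤ 1 / (b - a) * x := by
    rw [one_div_mul_eq_div, le_div_iff₀ hba]
    linarith [hx.1]
  have := Real.pi_gt_three
  exact Real.cos_pos_of_mem_Ioo ⟨by linarith, by linarith⟩

/-- The reciprocal of the weight `cos (x / (b - a))`. -/
noncomputable def invWeight (ha : a < 0) (hb : 0 < b) : C(Icc a b, ℝ) where
  toFun x := (Real.cos (1 / (b - a) * x))⁻¹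
  continuous_toFun := Continuous.inv₀ (by fun_prop) fun x => (cos_pos_of_mem_Icc ha hb x.2).ne'

/-- The operator `f ↦ (f - P f) / cos (x / (b - a))`. -/
noncomputable def weightedOp (ha : a < 0) (hb : 0 < b) (γ : ℝ) :
    C(Icc a b, ℝ) →L[ℝ] C(Icc a b, ℝ) :=
  (ContinuousLinearMap.mul ℝ C(Icc a b, ℝ) (invWeight ha hb)).comp
    (ContinuousLinearMap.id ℝ _ - opP ha hb γ)

theorem weightedOp_apply (f : C(Icc a b, ℝ)) (x : Icc a b) :
    weightedOp ha hb γ f x = (Real.cos (1 / (b - a) * x))⁻¹ * (f - opP ha hb γ f) x := rfl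

theorem abs_sub_opP_le (f : C(Icc a b, ℝ)) (x : Icc a b) :
    |(f - opP ha hb γ f) x| ≤ ‖weightedOp ha hb γ f‖ * Real.cos (1 / (b - a) * x) := by
  have hc := cos_pos_of_mem_Icc ha hb x.2
  have := (weightedOp ha hb γ f).norm_coe_le_norm x
  rwa [weightedOp_apply, norm_mul, norm_inv, Real.norm_of_nonneg hc.le, inv_mul_le_iff₀' hc] at this

theorem norm_weightedOp_le (f : C(Icc a b, ℝ)) {M : ℝ} (hM : 0 ≤ M)
    (h : ∀ x : Icc a b, |(f - opP ha hb γ f) x| ≤ M * Real.cos (1 / (b - a) * x)) :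
    ‖weightedOp ha hb γ f‖ ≤ M := by
  rw [ContinuousMap.norm_le _ hM]
  intro x
  have hc := cos_pos_of_mem_Icc ha hb x.2
  rw [weightedOp_apply, norm_mul, norm_inv, Real.norm_of_nonneg hc.le, inv_mul_le_iff₀' hc]
  exact h x

theorem norm_weightedOp_resolvent_le (hγ : 0 ≤ γ) {l : ℝ} (hl : 0 < l) {f h : C(Icc a b, ℝ)}
    (hf : (f, h) ∈ (opA ha hb γ).graph) :
    (l + (1 / (b - a)) ^ 2 / 2) * ‖weightedOp ha hb γ f‖ ≤ ‖weightedOp ha hb γ (l • f - h)‖ := by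
  have hpos : 0 < l + (1 / (b - a)) ^ 2 / 2 := by positivity
  rw [← le_div_iff₀' hpos]
  have hv : (f - opP ha hb γ f, h) ∈ (opA ha hb γ).graph := by
    simpa using (opA ha hb γ).graph.sub_mem hf (opP_mem_graph f)
  refine norm_weightedOp_le f (by positivity) fun x => ?_
  refine abs_le_of_resolvent_le hγ hv hl (fun y hy => cos_pos_of_mem_Icc ha hb hy)
    (Or.inr ⟨?_, ?_⟩) (norm_nonneg _) (fun y => ?_) x
  · rw [ContinuousMap.sub_apply, opP_apply_left hγ, sub_self]
  · rw [ContinuousMap.sub_apply, opP_apply_right hγ, sub_self]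
  · have := abs_sub_opP_le (ha := ha) (hb := hb) (γ := γ) (l • f - h) y
    rw [map_sub, map_smul, opP_eq_zero_of_mem_graph hf, sub_zero] at this
    convert this using 2
    simp only [ContinuousMap.sub_apply, ContinuousMap.smul_apply, smul_eq_mul]
    ring

theorem norm_op_sub_opP_le (hγ : 0 ≤ γ) {S : C0Semigroup C(Icc a b, ℝ)}
    (hS : S.IsGeneratedBy (opA ha hb γ))
    (hdecay : ∀ (L : C(Icc a b, ℝ) →L[ℝ] C(Icc a b, ℝ)) (c : ℝ), 0 ≤ c →
      (∀ l : ℝ, 0 < l → ∀ f h, (f, h) ∈ (opA ha hb γ).graph →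
        (l + c) * ‖L f‖ ≤ ‖L (l • f - h)‖) →
      ∀ t f, ‖L (S.op t f)‖ ≤ Real.exp (-c * (t : ℝ)) * ‖L f‖) (t : ℝ≥0) :
    ‖S.op t - opP ha hb γ‖ ≤
      ‖weightedOp ha hb γ‖ * Real.exp (-((1 / (b - a)) ^ 2 / 2) * (t : ℝ)) := by
  refine ContinuousLinearMap.opNorm_le_bound _ (by positivity) fun f => ?_
  set P := opP ha hb γ with hP
  have hPv : P (f - P f) = 0 := by rw [map_sub, opP_opP hγ, sub_self]
  have hz : (S.op t - P) f = S.op t (f - P f) := by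
    rw [map_sub, hS.op_eq_self (opP_mem_graph f)]
    rfl
  have hPz : P (S.op t (f - P f)) = 0 := by
    have := hdecay P 0 le_rfl (fun l hl g h hg => by
      rw [map_sub, opP_eq_zero_of_mem_graph hg, sub_zero, map_smul, norm_smul,
        Real.norm_of_nonneg hl.le, add_zero]) t (f - P f)
    rw [hPv, norm_zero, mul_zero] at this
    exact norm_le_zero_iff.1 this
  have hL := hdecay (weightedOp ha hb γ) ((1 / (b - a)) ^ 2 / 2) (by positivity)
    (fun l hl g h hg => norm_weightedOp_resolvent_le hγ hl hg) t (f - P f)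
  have hLf : weightedOp ha hb γ (f - P f) = weightedOp ha hb γ f := by
    ext x
    rw [weightedOp_apply, weightedOp_apply, ← hP, hPv, sub_zero]
  rw [hLf] at hL
  have hle : ‖S.op t (f - P f)‖ ≤ ‖weightedOp ha hb γ (S.op t (f - P f))‖ := by
    rw [ContinuousMap.norm_le _ (norm_nonneg _)]
    intro x
    have := abs_sub_opP_le (ha := ha) (hb := hb) (γ := γ) (S.op t (f - P f)) x
    rw [← hP, hPz, sub_zero] at this
    exact this.trans (mul_le_of_le_one_right (norm_nonneg _) (Real.cos_le_one _))
  rw [hz]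
  calc ‖S.op t (f - P f)‖ ≤ _ := hle.trans hL
    _ ≤ Real.exp (-((1 / (b - a)) ^ 2 / 2) * (t : ℝ)) * (‖weightedOp ha hb γ‖ * ‖f‖) := by
        gcongr
        exact (weightedOp ha hb γ).le_opNorm f
    _ = _ := by ring

end Decay

end KilledBM

theorem mainTheorem3 {a b : ℝ} (ha : a < 0) (hb : 0 < b) (γ : ℝ) (hγ : 0 ≤ γ) :
    (IsIdempotentElem (KilledBM.opP ha hb γ) ∧
      (KilledBM.opP ha hb γ).range =
        Submodule.span ℝ {KilledBM.ellStar a b γ, KilledBM.kStar a b γ}) ∧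
    ∃ S : KilledBM.C0Semigroup C(Set.Icc a b, ℝ),
      S.IsGeneratedBy (KilledBM.opA ha hb γ) ∧
      (∀ S' : KilledBM.C0Semigroup C(Set.Icc a b, ℝ),
        S'.IsGeneratedBy (KilledBM.opA ha hb γ) → S' = S) ∧
      ∃ K κ : ℝ, 0 ≤ K ∧ 0 < κ ∧
        ∀ t : NNReal, ‖S.op t - KilledBM.opP ha hb γ‖ ≤ K * Real.exp (-κ * (t : ℝ)) := by
  refine ⟨⟨ContinuousLinearMap.ext fun f => KilledBM.opP_opP hγ f, KilledBM.range_opP hγ⟩, ?_⟩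
  obtain ⟨S, hS, hSn, hdecay⟩ :=
    (KilledBM.isMDissipative_opA (ha := ha) (hb := hb) hγ).exists_semigroup
  have hba : 0 < b - a := by linarith
  exact ⟨S, hS, fun S' hS' => hS.unique hSn KilledBM.dense_domain_opA hS',
    ‖KilledBM.weightedOp ha hb γ‖, (1 / (b - a)) ^ 2 / 2, ContinuousLinearMap.opNorm_nonneg _,
    by positivity,
    KilledBM.norm_op_sub_opP_le hγ hS hdecay⟩
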